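/- For $\lambda,\mu\ge 0$, $\rho\in[0,1]$ and $\gamma>0$ put $$F(\lambda,\mu,\rho,\gamma)=\max\Big\{\frac{\lambda^2}{\gamma},\ \frac{\mu^2}{\gamma},\ \frac{\lambda^2\rho^2}{\gamma-\lambda^2+\lambda^2\rho^2}+\frac{\mu^2\rho^2}{\gamma-\mu^2+\mu^2\rho^2}\Big\}.$$ Let $\pi_*$ be a probability law on $\mathbb R^2$, not depending on $n$, such that for $(\mathbb X,\mathbb Y)\sim\pi_*$: (1) $\mathbb E[\mathbb X]=\mathbb E[\mathbb Y]=0$, $\mathbb E[\mathbb X^2]=\mathbb E[\mathbb Y^2]=1$ and $\mathbb E[\mathbb X\mathbb Y]=\rho$; (2) $\mathbb X$ and $\mathbb Y$ are subgaussian, i.e. for some constant $c\geq 0$, $\mathbb E[e^{t\mathbb X}]\le e^{ct^2/2}$ and $\mathbb E[e^{t\mathbb Y}]\le e^{ct^2/2}$ for all $t\in\mathbb R$; (3) $\mathbb E[\mathbb X^a\mathbb Y^b]^2\ge \mathbb E[\mathbb X^a]^2\,\mathbb E[\mathbb Y^b]^2$ for all $a,b\in\mathbb N$. For each $n$ let $(x_i,y_i)_{1\le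 i\le n}$ be i.i.d. from $\pi_*$, and let $\widehat{W},\widehat{Z}\in\mathbb R^{n\times n}$ have i.i.d. $\mathcal N(0,1)$ entries (all $2n^2$ entries independent, no symmetry imposed), independent of $(x,y)$. Let $\widehat{\mathbb P}=\widehat{\mathbb P}_n$ be the law of $$\Big(\tfrac{\lambda}{\sqrt{2n}}\,xx^\top+\widehat W,\ \tfrac{\mu}{\sqrt{2n}}\,yy^\top+\widehat Z\Big)$$ and $\widehat{\mathbb Q}=\widehat{\mathbb Q}_n$ the law of $(\widehat W,\widehat Z)$. For $D\in\mathbb N$ define the low-degree advantage $$\chi^2_{\le D}(\widehat{\mathbb P};\widehat{\mathbb Q})=\sup_{f\neq 0,\ \deg f\le D}\frac{\mathbb E_{\widehat{\mathbb P}}[f]}{\sqrt{\mathbb E_{\widehat{\mathbb Q}}[f^2]}},$$ the supremum being over nonzero real polynomials $f$ in the $2n^2$ matrix entries of total degree at most $D$. A sequence of such polynomials $f=f_n$ strongly separates $\widehat{\mathbb P}$ and $\widehat{\mathbb Q}$ if $\mathbb E_{\widehat{\mathbb P}}[f_n]\neq\mathbb E_{\widehat{\mathbb Q}}[f_n]$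 for all large $n$ and, as $n\to\infty$, $$\sqrt{\max\{\operatorname{Var}_{\widehat{\mathbb P}}(f_n),\operatorname{Var}_{\widehat{\mathbb Q}}(f_n)\}}=o\big(|\mathbb E_{\widehat{\mathbb P}}[f_n]-\mathbb E_{\widehat{\mathbb Q}}[f_n]|\big).$$ Suppose that $F(\lambda,\mu,\rho,1)<1-\epsilon$ for some constant $\epsilon>0$. Then for every sequence of natural numbers $D=D_n\le n^{o(1)}$ we have $\chi^2_{\le D_n}(\widehat{\mathbb P}_n;\widehat{\mathbb Q}_n)=O_{\lambda,\mu,\rho}(1)$. Precisely: there is a constant $K$ determined by $\lambda,\mu,\rho,\epsilon$ alone such that, for every $\pi_*$ and every $(D_n)$ as above, $\chi^2_{\le D_n}(\widehat{\mathbb P}_n;\widehat{\mathbb Q}_n)\le K$ for all sufficiently large $n$ (how large may depend on $\pi_*$ and $(D_n)$), and moreover $\sup_n\chi^2_{\le D_n}(\widehat{\mathbb P}_n;\widehat{\mathbb Q}_n)<\infty$. In particular, no sequence of polynomials $f_n$ with $\deg f_n\le D_n$ strongly separates $\widehat{\mathbb P}$ and $\widehat{\mathbb Q}$. -/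

import Mathlib

open MeasureTheory ProbabilityTheory Filter Topology Asymptotics
open scoped NNReal

noncomputable section

/-- The threshold function
`F(λ, μ, ρ, γ) = max {λ²/γ, μ²/γ, λ²ρ²/(γ - λ² + λ²ρ²) + μ²ρ²/(γ - μ² + μ²ρ²)}`. -/
def thresholdF (lam mu rho gam : ℝ) : ℝ :=
  max (lam ^ 2 / gam) (max (mu ^ 2 / gam)
    (lam ^ 2 * rho ^ 2 / (gam - lam ^ 2 + lam ^ 2 * rho ^ 2)
      + mu ^ 2 * rho ^ 2 / (gam - mu ^ 2 + mu ^ 2 * rho ^ 2)))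

/-- The assumptions on the law `prior` of one pair `(𝕏, 𝕐)` of spike coordinates. -/
structure SpikePrior (rho : ℝ) (prior : Measure (ℝ × ℝ)) : Prop where
  isProbabilityMeasure : IsProbabilityMeasure prior
  mean_fst : ∫ p, p.1 ∂prior = 0
  mean_snd : ∫ p, p.2 ∂prior = 0
  sq_fst : ∫ p, p.1 ^ 2 ∂prior = 1
  sq_snd : ∫ p, p.2 ^ 2 ∂prior = 1
  cross : ∫ p, p.1 * p.2 ∂prior = rho
  subgaussian : ∃ c : ℝ≥0, HasSubgaussianMGF (fun p : ℝ × ℝ => p.1) c prior ∧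
    HasSubgaussianMGF (fun p : ℝ × ℝ => p.2) c prior
  moment_le : ∀ a b : ℕ, (∫ p, p.1 ^ a ∂prior) ^ 2 * (∫ p, p.2 ^ b ∂prior) ^ 2
    ≤ (∫ p, p.1 ^ a * p.2 ^ b ∂prior) ^ 2

/-- Real `n × n` matrices, as a product space (with its product σ-algebra). -/
abbrev RMat (n : ℕ) : Type := Fin n → Fin n → ℝ

/-- The law of an `n × n` matrix with i.i.d. standard normal entries (no symmetry). -/
def noiseLaw (n : ℕ) : Measure (RMat n) :=
  Measure.pi fun _ => Measure.pi fun _ => gaussianReal 0 1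

/-- The null law: the joint law of two independent noise matrices. -/
def nullLaw (n : ℕ) : Measure (RMat n × RMat n) :=
  (noiseLaw n).prod (noiseLaw n)

/-- The rank-one spike `(s / √(2n)) v vᵀ`. -/
def spike {n : ℕ} (s : ℝ) (v : Fin n → ℝ) : RMat n :=
  fun i j => s / √(2 * (n : ℝ)) * (v i * v j)

/-- The planted law: the law of `((λ/√(2n)) x xᵀ + W, (μ/√(2n)) y yᵀ + Z)`, where the pairs
`(x i, y i)` are i.i.d. from `prior` and independent of the noise `(W, Z)`. -/
def plantedLaw (lam mu : ℝ) (prior : Measure (ℝ × ℝ)) (n : ℕ) : Measure (RMat n × RMat n) :=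
  ((Measure.pi fun _ : Fin n => prior).prod (nullLaw n)).map fun ω =>
    (spike lam (fun i => (ω.1 i).1) + ω.2.1, spike mu (fun i => (ω.1 i).2) + ω.2.2)

/-- One variable for each entry of the first matrix (`Sum.inl`) and of the second (`Sum.inr`). -/
abbrev EntryIdx (n : ℕ) : Type := (Fin n × Fin n) ⊕ (Fin n × Fin n)

/-- Real polynomials in the entries of a pair of `n × n` matrices. -/
abbrev MatPoly (n : ℕ) : Type := MvPolynomial (EntryIdx n) ℝ

/-- The value of a polynomial at a pair of matrices. -/
def evalPoly {n : ℕ} (f : MatPoly n) (M : RMat n × RMat n) : ℝ :=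
  MvPolynomial.eval (Sum.elim (fun e => M.1 e.1 e.2) (fun e => M.2 e.1 e.2)) f

/-- The degree-`D` advantage `sup {E_P[f] / √(E_Q[f²]) : f ≠ 0, deg f ≤ D}`, as an extended real
number, so that an infinite supremum is `⊤`. -/
def lowDegreeAdvantage {n : ℕ} (D : ℕ) (P Q : Measure (RMat n × RMat n)) : EReal :=
  ⨆ f : {f : MatPoly n // f ≠ 0 ∧ f.totalDegree ≤ D},
    (((∫ M, evalPoly f.1 M ∂P) / √(∫ M, evalPoly f.1 M ^ 2 ∂Q) : ℝ) : EReal)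

/-- The absolute difference of the means of `f` under `P` and `Q`. -/
def meanGap {n : ℕ} (P Q : Measure (RMat n × RMat n)) (f : MatPoly n) : ℝ :=
  |(∫ M, evalPoly f M ∂P) - ∫ M, evalPoly f M ∂Q|

/-- Strong separation: `√(max (Var_P f) (Var_Q f)) = o(|E_P f - E_Q f|)` as `n → ∞`, the right-hand
side being positive for all large `n`, so that the ratio of the two sides makes sense. -/
def StronglySeparates (P Q : ∀ n : ℕ, Measure (RMat n × RMat n)) (f : ∀ n : ℕ, MatPoly n) : Prop :=
  (∀ᶠ n in atTop, 0 < meanGap (P n) (Q n) (f n)) ∧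
    (fun n => √(max (variance (evalPoly (f n)) (P n)) (variance (evalPoly (f n)) (Q n))))
      =o[atTop] fun n => meanGap (P n) (Q n) (f n)

/-- `D = n^{o(1)}`: there is a sequence `δ n → 0` with `D n ≤ n ^ (δ n)` for all large `n`. -/
def IsSubpolynomial (D : ℕ → ℕ) : Prop :=
  ∃ δ : ℕ → ℝ, Tendsto δ atTop (𝓝 0) ∧ ∀ᶠ n in atTop, (D n : ℝ) ≤ (n : ℝ) ^ δ n

end

/-! ### Functions with finite absolute moments -/

noncomputable section

/-! Write the planted pair as `t + noise`, with `t` the vector of spike entries. In the Hermite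
basis `E_P f = ∑ c_a E[t^a]` and `E_Q f² = ∑ c_a² a!`, so Cauchy–Schwarz bounds the squared
advantage by `∑_{d ≤ D} E⟨t, t'⟩^d / d!` over two independent copies (`sq_integral_shift_le`). Here
`⟨t, t'⟩ = (A² + B²)/2`, with `A = λ/√n ∑ xᵢxᵢ'` and `B = μ/√n ∑ yᵢyᵢ'`.

Since `((A² + B²)/2)^d / d! = E_g (g₁A + g₂B)^{2d} / (2d)!` for a standard Gaussian pair `g`, this
sum is the `g`-average of a truncated cosh moment `T(g)` (`SpikePrior.overlapSum_eq`). The full cosh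
moment is an average of two `n`-th powers of one-coordinate generating functions, whose second-order
expansion gives `T(g) ≤ exp((1-δ)|g|²/2)` for `|g|² ≤ κ²n` (`SpikePrior.exists_truncCosh_le_local`).
The threshold condition enters only there: it says that the limiting quadratic form is strictly
below the Euclidean one (`exists_gap_of_thresholdF_lt`).

For larger `|g|` the truncation helps: `T` grows at most like `|g|^{2D}` along rays, which is slower
than the Gaussian exponential as soon as `D ≤ c n` (`SpikePrior.exists_overlapSum_le`). Integrating
over `g` gives a bound depending on `δ` alone. Applied to `f` minus its null mean, the same bound
controls the mean gap by the null standard deviation, which rules out strong separation. -/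

/-- A real function all of whose absolute moments are finite. -/
def HasAllMoments {Ω : Type*} [MeasurableSpace Ω] (f : Ω → ℝ) (μ : Measure Ω) : Prop :=
  ∀ p : ℝ≥0, MemLp f p μ

namespace HasAllMoments

variable {Ω Ω' : Type*} [MeasurableSpace Ω] [MeasurableSpace Ω'] {μ : Measure Ω}
  {ν : Measure Ω'} {f g : Ω → ℝ}

lemma add (hf : HasAllMoments f μ) (hg : HasAllMoments g μ) :
    HasAllMoments (fun x => f x + g x) μ := fun p => (hf p).add (hg p)

/-- Hölder with exponents `2p, 2p`. Asking for every finite `p` at once makes the class an algebra,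
so integrability of polynomial expressions follows from their structure. -/
lemma mul (hf : HasAllMoments f μ) (hg : HasAllMoments g μ) :
    HasAllMoments (fun x => f x * g x) μ := fun p => by
  have : ENNReal.HolderTriple (((2 * p : ℝ≥0)) : ENNReal) ((2 * p : ℝ≥0) : ENNReal) p := by
    constructor
    push_cast
    rw [ENNReal.mul_inv (by simp) (by simp), ← add_mul, ENNReal.inv_two_add_inv_two, one_mul]
  exact (hg (2 * p)).mul' (hf (2 * p))

lemma const [IsFiniteMeasure μ] (c : ℝ) : HasAllMoments (fun _ : Ω => c) μ :=
  fun _ => memLp_const c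

lemma pow [IsFiniteMeasure μ] (hf : HasAllMoments f μ) (n : ℕ) :
    HasAllMoments (fun x => f x ^ n) μ := by
  induction n with
  | zero => simpa using const (μ := μ) 1
  | succ n ih => simpa only [pow_succ] using ih.mul hf

lemma sum {ι : Type*} (s : Finset ι) {F : ι → Ω → ℝ}
    (hF : ∀ i ∈ s, HasAllMoments (F i) μ) : HasAllMoments (fun x => ∑ i ∈ s, F i x) μ :=
  fun p => memLp_finsetSum s fun i hi => hF i hi p

lemma prod [IsFiniteMeasure μ] {ι : Type*} (s : Finset ι) {F : ι → Ω → ℝ}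
    (hF : ∀ i ∈ s, HasAllMoments (F i) μ) : HasAllMoments (fun x => ∏ i ∈ s, F i x) μ := by
  classical
  induction s using Finset.induction_on with
  | empty => simpa using const (μ := μ) 1
  | insert a s ha ih =>
    simp only [Finset.prod_insert ha]
    exact (hF a (by simp)).mul (ih fun i hi => hF i (by simp [hi]))

lemma polynomial_eval [IsFiniteMeasure μ] (hf : HasAllMoments f μ) (p : Polynomial ℝ) :
    HasAllMoments (fun x => p.eval (f x)) μ := by
  simp only [Polynomial.eval_eq_sum_range]
  exact sum _ fun i _ => (const _).mul (hf.pow i)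

lemma comp_measurePreserving {φ : Ω' → Ω} (hf : HasAllMoments f μ)
    (hφ : MeasurePreserving φ ν μ) : HasAllMoments (fun x => f (φ x)) ν :=
  fun p => (hf p).comp_measurePreserving hφ

lemma integrable (hf : HasAllMoments f μ) : Integrable f μ :=
  memLp_one_iff_integrable.1 (by simpa using hf 1)

end HasAllMoments

lemma ProbabilityTheory.HasSubgaussianMGF.hasAllMoments {Ω : Type*} [MeasurableSpace Ω]
    {μ : Measure Ω} {f : Ω → ℝ} {c : ℝ≥0} (h : HasSubgaussianMGF f c μ) : HasAllMoments f μ :=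
  fun p => h.memLp p

/-! ### Hermite polynomials and Gaussian integration by parts -/

/-- The standard Gaussian law on the line. -/
abbrev stdGauss : Measure ℝ := gaussianReal 0 1

lemma hasAllMoments_id_stdGauss : HasAllMoments (fun x : ℝ => x) stdGauss :=
  fun p => memLp_id_gaussianReal p

lemma integrable_polynomial_stdGauss (p : Polynomial ℝ) :
    Integrable (fun x => p.eval x) stdGauss :=
  (hasAllMoments_id_stdGauss.polynomial_eval p).integrable

lemma integrable_mul_polynomial_stdGauss (p : Polynomial ℝ) :
    Integrable (fun x => x * p.eval x) stdGauss :=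
  (integrable_polynomial_stdGauss (Polynomial.X * p)).congr (ae_of_all _ fun x => by simp)

lemma hasDerivAt_gaussianPDFReal_std (x : ℝ) :
    HasDerivAt (gaussianPDFReal 0 1) (-(x * gaussianPDFReal 0 1 x)) x := by
  have h : HasDerivAt (fun x : ℝ => (√(2 * Real.pi * (1 : ℝ≥0)))⁻¹
      * Real.exp (-(x - 0) ^ 2 / (2 * (1 : ℝ≥0))))
      ((√(2 * Real.pi * (1 : ℝ≥0)))⁻¹ * (Real.exp (-(x - 0) ^ 2 / (2 * (1 : ℝ≥0))) *
        (-(2 * (x - 0)) / (2 * (1 : ℝ≥0))))) x := by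
    refine HasDerivAt.const_mul _ (HasDerivAt.exp ?_)
    refine HasDerivAt.div_const ?_ _
    convert! (((hasDerivAt_id x).sub_const 0).pow 2).neg using 1
    simp
  rw [gaussianPDFReal_def]
  convert! h using 1
  simp
  ring

/-- Gaussian integration by parts for polynomials. -/
lemma integral_mul_polynomial_stdGauss (p : Polynomial ℝ) :
    ∫ x, x * p.eval x ∂stdGauss = ∫ x, p.derivative.eval x ∂stdGauss := by
  have hI : ∀ q : Polynomial ℝ, Integrable (fun x => q.eval x * gaussianPDFReal 0 1 x) := by
    intro q
    have h := integrable_polynomial_stdGauss q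
    rw [stdGauss, gaussianReal_of_var_ne_zero _ one_ne_zero,
      integrable_withDensity_iff_integrable_smul' (measurable_gaussianPDF _ _)
        (ae_of_all _ fun _ => gaussianPDF_lt_top)] at h
    simpa [toReal_gaussianPDF, mul_comm] using h
  have h := integral_mul_deriv_eq_deriv_mul_of_integrable
    (u := fun x => p.eval x) (u' := fun x => p.derivative.eval x)
    (v := gaussianPDFReal 0 1) (v' := fun x => -(x * gaussianPDFReal 0 1 x))
    (fun x _ => p.hasDerivAt x) (fun x _ => hasDerivAt_gaussianPDFReal_std x)
    (by
      refine (hI (-(Polynomial.X * p))).congr (ae_of_all _ fun x => ?_)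
      simp; ring)
    (hI _) (hI _)
  rw [integral_gaussianReal_eq_integral_smul one_ne_zero,
    integral_gaussianReal_eq_integral_smul one_ne_zero]
  rw [← neg_inj, ← integral_neg]
  calc _ = ∫ x, p.eval x * -(x * gaussianPDFReal 0 1 x) := by
        congr 1; ext x; simp; ring
    _ = _ := by
        rw [h]; congr 2; ext x; simp [mul_comm]

/-- The probabilists' Hermite polynomial over the reals. -/
def realHermite (k : ℕ) : Polynomial ℝ := (Polynomial.hermite k).map (Int.castRingHom ℝ)

lemma realHermite_zero : realHermite 0 = 1 := by simp [realHermite]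

lemma realHermite_succ (k : ℕ) :
    realHermite (k + 1) = Polynomial.X * realHermite k - (realHermite k).derivative := by
  simp [realHermite, Polynomial.hermite_succ, Polynomial.derivative_map]

lemma realHermite_monic (k : ℕ) : (realHermite k).Monic :=
  (Polynomial.hermite_monic k).map _

lemma natDegree_realHermite (k : ℕ) : (realHermite k).natDegree = k := by
  rw [realHermite, (Polynomial.hermite_monic k).natDegree_map, Polynomial.natDegree_hermite]

/-- Integration by parts applied to `H_k q` produces `H_k' q + H_k q'`, and the recursion for
`H_{k+1}` removes the first term. Iterating moves all `k` derivatives onto `q`. -/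
lemma integral_realHermite_succ_mul (k : ℕ) (q : Polynomial ℝ) :
    ∫ x, (realHermite (k + 1)).eval x * q.eval x ∂stdGauss
      = ∫ x, (realHermite k).eval x * q.derivative.eval x ∂stdGauss := by
  have h := integral_mul_polynomial_stdGauss (realHermite k * q)
  have e1 : ∀ x, (realHermite (k + 1)).eval x * q.eval x
      = x * (realHermite k * q).eval x - ((realHermite k).derivative * q).eval x := by
    intro x; simp [realHermite_succ]; ring
  simp_rw [e1]
  rw [integral_sub, h, ← integral_sub]
  · congr 1; ext x; simp
  · exact integrable_polynomial_stdGauss _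
  · exact integrable_polynomial_stdGauss _
  · exact integrable_mul_polynomial_stdGauss _
  · exact integrable_polynomial_stdGauss _

lemma integral_realHermite_mul (k : ℕ) (q : Polynomial ℝ) :
    ∫ x, (realHermite k).eval x * q.eval x ∂stdGauss
      = ∫ x, (Polynomial.derivative^[k] q).eval x ∂stdGauss := by
  induction k generalizing q with
  | zero => simp [realHermite_zero]
  | succ k ih => rw [integral_realHermite_succ_mul, ih, Function.iterate_succ_apply]

/-- Orthogonality of the Hermite polynomials. -/
lemma integral_realHermite_mul_realHermite (j k : ℕ) :
    ∫ x, (realHermite j).eval x * (realHermite k).eval x ∂stdGauss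
      = if j = k then (j.factorial : ℝ) else 0 := by
  have key : ∀ j k : ℕ, k < j →
      ∫ x, (realHermite j).eval x * (realHermite k).eval x ∂stdGauss = 0 := by
    intro j k h
    rw [integral_realHermite_mul,
      Polynomial.iterate_derivative_eq_zero (by rwa [natDegree_realHermite])]
    simp
  rcases lt_trichotomy j k with h | h | h
  · rw [if_neg h.ne, ← key k j h]
    simp_rw [mul_comm]
  · subst h
    have e : Polynomial.derivative^[j] (realHermite j) = Polynomial.C (j.factorial : ℝ) := by
      have hd : (Polynomial.derivative^[j] (realHermite j)).natDegree = 0 := by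
        have := Polynomial.natDegree_iterate_derivative (realHermite j) j
        rw [natDegree_realHermite] at this
        omega
      rw [Polynomial.eq_C_of_natDegree_eq_zero hd, Polynomial.coeff_iterate_derivative]
      have := realHermite_monic j
      rw [Polynomial.Monic, Polynomial.leadingCoeff, natDegree_realHermite] at this
      simp [this, Nat.descFactorial_self]
    rw [integral_realHermite_mul, e]
    simp
  · rw [if_neg h.ne', key j k h]

/-- The Gaussian average of a shifted Hermite polynomial is a monomial in the shift. -/
lemma integral_realHermite_shift (k : ℕ) (t : ℝ) :
    ∫ x, (realHermite k).eval (t + x) ∂stdGauss = t ^ k := by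
  induction k with
  | zero => simp [realHermite_zero]
  | succ k ih =>
    set p : Polynomial ℝ := (realHermite k).comp (Polynomial.C t + Polynomial.X) with hp
    have h := integral_mul_polynomial_stdGauss p
    -- The bracket has Gaussian mean zero by integration by parts, so raising the degree multiplies
    -- the average by `t`.
    have e : ∀ x, (realHermite (k + 1)).eval (t + x)
        = t * p.eval x + (x * p.eval x - p.derivative.eval x) := by
      intro x; simp [hp, realHermite_succ, Polynomial.derivative_comp]; ring
    have i1 := integrable_mul_polynomial_stdGauss p
    have i2 : Integrable (fun x => x * p.eval x - p.derivative.eval x) stdGauss :=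
      i1.sub (integrable_polynomial_stdGauss _)
    simp_rw [e]
    rw [integral_add ((integrable_polynomial_stdGauss p).const_mul t) i2,
      integral_sub i1 (integrable_polynomial_stdGauss _), h, sub_self, add_zero,
      integral_const_mul, pow_succ', ← ih]
    simp [hp]

/-- The three-term recurrence, which keeps the Hermite span stable under multiplication by a
coordinate. At `k = 0` the truncated `k - 1` is harmless because its coefficient vanishes. -/
lemma mul_eval_realHermite (k : ℕ) (x : ℝ) :
    x * (realHermite k).eval x
      = (realHermite (k + 1)).eval x + k * (realHermite (k - 1)).eval x := by
  have key : ∀ k : ℕ, (realHermite (k + 1)).derivative = ((k + 1 : ℕ) : Polynomial ℝ) * realHermite k := by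
    intro k
    induction k with
    | zero => simp [realHermite_succ, realHermite_zero]
    | succ k ih =>
      rw [realHermite_succ (k + 1), Polynomial.derivative_sub, Polynomial.derivative_mul, ih,
        Polynomial.derivative_mul, Polynomial.derivative_natCast, realHermite_succ k]
      simp only [Polynomial.derivative_X]
      push_cast
      ring
  cases k with
  | zero => simp [realHermite_succ, realHermite_zero]
  | succ k =>
    rw [realHermite_succ (k + 1), Polynomial.eval_sub, key k]
    simp

end

/-! ### Hermite expansion of multivariate polynomials -/

noncomputable section

section Expansion

variable {σ : Type*} [Fintype σ]

/-- The product Hermite function with multi-index `a`. -/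
def multiHermite (a : σ → ℕ) (w : σ → ℝ) : ℝ := ∏ e, (realHermite (a e)).eval (w e)

/-- The multi-indices of total degree at most `D`. -/
def multiIdx (σ : Type*) [Fintype σ] (D : ℕ) : Finset (σ → ℕ) := by
  classical exact (Finset.range (D + 1)).biUnion fun d => Finset.piAntidiag Finset.univ d

lemma mem_multiIdx {D : ℕ} {a : σ → ℕ} : a ∈ multiIdx σ D ↔ ∑ e, a e ≤ D := by
  classical
  simp [multiIdx]

lemma coord_mul_multiHermite (i : σ) (a : σ → ℕ) (w : σ → ℝ) [DecidableEq σ] :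
    w i * multiHermite a w = multiHermite (Function.update a i (a i + 1)) w
      + a i * multiHermite (Function.update a i (a i - 1)) w := by
  have key : ∀ k, multiHermite (Function.update a i k) w
      = (realHermite k).eval (w i) *
        ∏ e ∈ Finset.univ.erase i, (realHermite (a e)).eval (w e) := by
    intro k
    rw [multiHermite, ← Finset.mul_prod_erase _ _ (Finset.mem_univ i), Function.update_self]
    congr 1
    refine Finset.prod_congr rfl fun e he => ?_
    rw [Function.update_of_ne (Finset.ne_of_mem_erase he)]
  have h := key (a i)
  rw [Function.update_eq_self] at h
  rw [h, key, key, ← mul_assoc, mul_eval_realHermite]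
  ring

/-- The span of the product Hermite functions of degree at most `D`. -/
def hermiteSpan (σ : Type*) [Fintype σ] (D : ℕ) : Submodule ℝ ((σ → ℝ) → ℝ) :=
  Submodule.span ℝ (multiHermite '' (multiIdx σ D : Set (σ → ℕ)))

lemma multiHermite_mem_hermiteSpan {D : ℕ} {a : σ → ℕ} (h : ∑ e, a e ≤ D) :
    multiHermite a ∈ hermiteSpan σ D :=
  Submodule.subset_span ⟨a, by simpa [mem_multiIdx] using h, rfl⟩

lemma coord_mul_mem_hermiteSpan {D : ℕ} (i : σ) {F : (σ → ℝ) → ℝ} (hF : F ∈ hermiteSpan σ D) :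
    (fun w => w i * F w) ∈ hermiteSpan σ (D + 1) := by
  classical
  induction hF using Submodule.span_induction with
  | mem F hF =>
    obtain ⟨a, ha, rfl⟩ := hF
    have ha : ∑ e, a e ≤ D := mem_multiIdx.1 (by simpa using ha)
    have e : (fun w => w i * multiHermite a w)
        = multiHermite (Function.update a i (a i + 1))
          + (a i : ℝ) • multiHermite (Function.update a i (a i - 1)) := by
      ext w; simp [coord_mul_multiHermite]
    have hsum : ∀ k, (∑ e, Function.update a i k e) + a i = (∑ e, a e) + k := by
      intro k
      rw [Finset.sum_update_of_mem (Finset.mem_univ i), Finset.sdiff_singleton_eq_erase,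
        ← Finset.add_sum_erase _ a (Finset.mem_univ i)]
      ring
    rw [e]
    refine Submodule.add_mem _ (multiHermite_mem_hermiteSpan ?_)
      (Submodule.smul_mem _ _ (multiHermite_mem_hermiteSpan ?_))
    · have := hsum (a i + 1); omega
    · have := hsum (a i - 1); omega
  | zero =>
    have : (fun w : σ → ℝ => w i * (0 : (σ → ℝ) → ℝ) w) = 0 := by ext w; simp
    rw [this]; exact Submodule.zero_mem _
  | add F G _ _ hF hG =>
    have : (fun w : σ → ℝ => w i * (F + G) w) = (fun w => w i * F w) + fun w => w i * G w := by
      ext w; simp [mul_add]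
    rw [this]; exact Submodule.add_mem _ hF hG
  | smul c F _ hF =>
    have : (fun w : σ → ℝ => w i * (c • F) w) = c • fun w => w i * F w := by
      ext w; simp; ring
    rw [this]; exact Submodule.smul_mem _ _ hF

/-- Induction on the degree: peel off one coordinate with positive exponent and multiply it back
through the three-term recurrence. -/
lemma monomial_mem_hermiteSpan (a : σ → ℕ) :
    (fun w : σ → ℝ => ∏ e, w e ^ a e) ∈ hermiteSpan σ (∑ e, a e) := by
  classical
  induction h : ∑ e, a e generalizing a with
  | zero =>
    have ha : ∀ e, a e = 0 := by simpa using h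
    have : (fun w : σ → ℝ => ∏ e, w e ^ a e) = multiHermite a := by
      ext w; simp [multiHermite, ha, realHermite_zero]
    rw [this]; exact multiHermite_mem_hermiteSpan h.le
  | succ d ih =>
    obtain ⟨i, hi⟩ : ∃ i, a i ≠ 0 := by
      by_contra! hc
      simp [hc] at h
    set b := Function.update a i (a i - 1) with hb
    have hab : a = Function.update b i (b i + 1) := by
      ext e
      by_cases he : e = i
      · subst he; simp [hb]; omega
      · simp [hb, he]
    have hs : ∑ e, b e = d := by
      rw [← Finset.add_sum_erase _ _ (Finset.mem_univ i)] at h ⊢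
      have : ∑ e ∈ Finset.univ.erase i, b e = ∑ e ∈ Finset.univ.erase i, a e :=
        Finset.sum_congr rfl fun e he => by
          rw [hb, Function.update_of_ne (Finset.ne_of_mem_erase he)]
      rw [this, hb, Function.update_self]
      omega
    have : (fun w : σ → ℝ => ∏ e, w e ^ a e) = fun w => w i * ∏ e, w e ^ b e := by
      ext w
      rw [← Finset.mul_prod_erase _ _ (Finset.mem_univ i),
        ← Finset.mul_prod_erase _ (fun e => w e ^ b e) (Finset.mem_univ i), ← mul_assoc, ← pow_succ']
      congr 1
      · rw [hb, Function.update_self]; congr 1; omega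
      · refine Finset.prod_congr rfl fun e he => ?_
        rw [hb, Function.update_of_ne (Finset.ne_of_mem_erase he)]
    rw [this]
    exact coord_mul_mem_hermiteSpan i (ih b hs)

lemma hermiteSpan_mono {D D' : ℕ} (h : D ≤ D') : hermiteSpan σ D ≤ hermiteSpan σ D' :=
  Submodule.span_mono <| Set.image_mono fun _ ha => by
    simp only [Finset.mem_coe, mem_multiIdx] at ha ⊢
    exact ha.trans h

/-- Every polynomial of degree at most `D` is a combination of Hermite functions of degree at
most `D`. -/
lemma exists_hermite_expansion {D : ℕ} (f : MvPolynomial σ ℝ) (hf : f.totalDegree ≤ D) :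
    ∃ c : (σ → ℕ) → ℝ, ∀ w, MvPolynomial.eval w f
      = ∑ a ∈ multiIdx σ D, c a * multiHermite a w := by
  classical
  have h : (fun w => MvPolynomial.eval w f) ∈ hermiteSpan σ D := by
    have : (fun w => MvPolynomial.eval w f)
        = ∑ s ∈ f.support, f.coeff s • fun w : σ → ℝ => ∏ e, w e ^ s e := by
      ext w; simp [MvPolynomial.eval_eq']
    rw [this]
    refine Submodule.sum_mem _ fun s hs => Submodule.smul_mem _ _ ?_
    refine hermiteSpan_mono ?_ (monomial_mem_hermiteSpan (s : σ → ℕ))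
    have := MvPolynomial.le_totalDegree hs
    rw [Finsupp.sum_fintype _ _ (by simp)] at this
    exact this.trans hf
  rw [hermiteSpan, Submodule.mem_span_image_finset_iff_exists_fun] at h
  obtain ⟨c, hc⟩ := h
  refine ⟨fun a => if h : a ∈ multiIdx σ D then c ⟨a, h⟩ else 0, fun w => ?_⟩
  rw [← Finset.sum_coe_sort]
  have := congrFun hc w
  simpa using this.symm

end Expansion

/-! ### Low-degree second moment bound for Gaussian noise -/

/-- All entries of a pair of matrices. -/
def entries {n : ℕ} (M : RMat n × RMat n) : EntryIdx n → ℝ :=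
  Sum.elim (fun e => M.1 e.1 e.2) fun e => M.2 e.1 e.2

lemma evalPoly_eq {n : ℕ} (f : MatPoly n) (M : RMat n × RMat n) :
    evalPoly f M = MvPolynomial.eval (entries M) f := rfl

instance (n : ℕ) : IsProbabilityMeasure (noiseLaw n) := by unfold noiseLaw; infer_instance

instance (n : ℕ) : IsProbabilityMeasure (nullLaw n) := by unfold nullLaw; infer_instance

lemma integral_prod_entries (n : ℕ) (F : EntryIdx n → ℝ → ℝ) :
    ∫ M, ∏ e, F e (entries M e) ∂nullLaw n = ∏ e, ∫ x, F e x ∂stdGauss := by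
  have h : ∀ G : Fin n × Fin n → ℝ → ℝ,
      ∫ A, ∏ e : Fin n × Fin n, G e (A e.1 e.2) ∂noiseLaw n = ∏ e, ∫ x, G e x ∂stdGauss := by
    intro G
    simp only [Fintype.prod_prod_type]
    rw [noiseLaw, integral_fintype_prod_eq_prod (fun i (v : Fin n → ℝ) => ∏ j, G (i, j) (v j))]
    refine Finset.prod_congr rfl fun i _ => ?_
    rw [integral_fintype_prod_eq_prod (fun j (x : ℝ) => G (i, j) x)]
  simp only [Fintype.prod_sum_type, entries, Sum.elim_inl, Sum.elim_inr]
  rw [nullLaw, ← h, ← h]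
  exact integral_prod_mul (fun A : RMat n => ∏ e : Fin n × Fin n, F (Sum.inl e) (A e.1 e.2))
    (fun A : RMat n => ∏ e : Fin n × Fin n, F (Sum.inr e) (A e.1 e.2))

lemma hasAllMoments_entries (n : ℕ) (e : EntryIdx n) :
    HasAllMoments (fun M => entries M e) (nullLaw n) := by
  have h : ∀ i j : Fin n, HasAllMoments (fun A : RMat n => A i j) (noiseLaw n) := fun i j =>
    hasAllMoments_id_stdGauss.comp_measurePreserving
      ((measurePreserving_eval (fun _ : Fin n => stdGauss) j).comp
        (measurePreserving_eval (fun _ : Fin n => Measure.pi fun _ : Fin n => stdGauss) i))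
  rcases e with e | e
  · exact (h e.1 e.2).comp_measurePreserving measurePreserving_fst
  · exact (h e.1 e.2).comp_measurePreserving measurePreserving_snd

lemma hasAllMoments_multiHermite {σ Ω : Type*} [Fintype σ] [MeasurableSpace Ω] {μ : Measure Ω}
    [IsFiniteMeasure μ] {w : Ω → σ → ℝ} (hw : ∀ e, HasAllMoments (fun x => w x e) μ)
    (a : σ → ℕ) : HasAllMoments (fun x => multiHermite a (w x)) μ :=
  HasAllMoments.prod _ fun e _ => (hw e).polynomial_eval _

lemma integral_multiHermite_mul (n : ℕ) (a b : EntryIdx n → ℕ) :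
    ∫ M, multiHermite a (entries M) * multiHermite b (entries M) ∂nullLaw n
      = if a = b then ∏ e, ((a e).factorial : ℝ) else 0 := by
  simp only [multiHermite, ← Finset.prod_mul_distrib]
  rw [integral_prod_entries n (fun e x => (realHermite (a e)).eval x * (realHermite (b e)).eval x)]
  simp only [integral_realHermite_mul_realHermite]
  split_ifs with h
  · simp [h]
  · obtain ⟨e, he⟩ := Function.ne_iff.1 h
    exact Finset.prod_eq_zero (Finset.mem_univ e) (if_neg he)

lemma integral_multiHermite_shift (n : ℕ) (a : EntryIdx n → ℕ) (t : EntryIdx n → ℝ) :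
    ∫ M, multiHermite a (t + entries M) ∂nullLaw n = ∏ e, t e ^ a e := by
  simp only [multiHermite, Pi.add_apply]
  rw [integral_prod_entries n (fun e x => (realHermite (a e)).eval (t e + x))]
  simp only [integral_realHermite_shift]

lemma integral_sq_hermite_sum (n D : ℕ) (c : (EntryIdx n → ℕ) → ℝ) :
    ∫ M, (∑ a ∈ multiIdx _ D, c a * multiHermite a (entries M)) ^ 2 ∂nullLaw n
      = ∑ a ∈ multiIdx _ D, c a ^ 2 * ∏ e, ((a e).factorial : ℝ) := by
  have hm := fun a => hasAllMoments_multiHermite (hasAllMoments_entries n) a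
  simp only [sq, Finset.sum_mul_sum]
  rw [integral_finsetSum]
  · refine Finset.sum_congr rfl fun a ha => ?_
    rw [integral_finsetSum]
    · rw [Finset.sum_eq_single_of_mem a ha]
      · simp_rw [mul_mul_mul_comm (c a)]
        rw [integral_const_mul, integral_multiHermite_mul, if_pos rfl]
      · intro b _ hb
        simp_rw [mul_mul_mul_comm (c a)]
        rw [integral_const_mul, integral_multiHermite_mul, if_neg hb.symm, mul_zero]
    · intro b _
      exact (((HasAllMoments.const _).mul (hm a)).mul ((HasAllMoments.const _).mul (hm b))).integrable
  · intro a _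
    exact (HasAllMoments.sum _ fun b _ =>
      ((HasAllMoments.const _).mul (hm a)).mul ((HasAllMoments.const _).mul (hm b))).integrable

/-- The overlap expansion of the squared moments of a random vector. -/
lemma sum_sq_moments_eq {σ Ω : Type*} [Fintype σ] [MeasurableSpace Ω] (ν : Measure Ω)
    [IsProbabilityMeasure ν] (t : Ω → σ → ℝ) (ht : ∀ e, HasAllMoments (fun x => t x e) ν) (D : ℕ) :
    ∑ a ∈ multiIdx σ D, (∫ x, ∏ e, t x e ^ a e ∂ν) ^ 2 / ∏ e, ((a e).factorial : ℝ)
      = ∑ d ∈ Finset.range (D + 1),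
        (∫ p, (∑ e, t p.1 e * t p.2 e) ^ d ∂(ν.prod ν)) / (d.factorial : ℝ) := by
  classical
  rw [multiIdx, Finset.sum_biUnion]
  · refine Finset.sum_congr rfl fun d _ => ?_
    have hm : ∀ a : σ → ℕ, HasAllMoments (fun x => ∏ e, t x e ^ a e) ν := fun a =>
      HasAllMoments.prod _ fun e _ => (ht e).pow _
    -- Multinomial expansion of `⟨t, t'⟩^d`: independence of the copies turns each monomial into a
    -- squared moment, and `multinomial / d! = 1 / ∏ a!`.
    simp_rw [Finset.sum_pow_eq_sum_piAntidiag, mul_pow, Finset.prod_mul_distrib]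
    rw [integral_finsetSum, Finset.sum_div]
    · refine Finset.sum_congr rfl fun a ha => ?_
      rw [integral_const_mul, integral_prod_mul (fun x => ∏ e, t x e ^ a e)
        (fun x => ∏ e, t x e ^ a e), ← sq]
      have hs : ∑ e, a e = d := by simpa using ha
      have h := Nat.multinomial_spec Finset.univ a
      rw [hs] at h
      have h' : (∏ e, ((a e).factorial : ℝ)) * (Nat.multinomial Finset.univ a : ℝ)
          = d.factorial := by exact_mod_cast h
      have h1 : (∏ e, ((a e).factorial : ℝ)) ≠ 0 :=
        Finset.prod_ne_zero_iff.2 fun e _ => by positivity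
      rw [← h']
      have h2 : (Nat.multinomial Finset.univ a : ℝ) ≠ 0 := by
        intro h0; rw [h0, mul_zero] at h'; exact absurd h'.symm (by positivity)
      field_simp
    · intro a _
      exact ((HasAllMoments.const _).mul
        (((hm a).comp_measurePreserving measurePreserving_fst).mul
          ((hm a).comp_measurePreserving measurePreserving_snd))).integrable
  · intro d _ d' _ hdd
    rw [Function.onFun, Finset.disjoint_left]
    intro a h1 h2
    simp only [Finset.mem_piAntidiag] at h1 h2
    exact hdd (h1.1.symm.trans h2.1)

/-- Low-degree second moment bound for a Gaussian additive model. -/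
lemma sq_integral_shift_le {Ω : Type*} [MeasurableSpace Ω] (n D : ℕ) (ν : Measure Ω)
    [IsProbabilityMeasure ν] (t : Ω → EntryIdx n → ℝ)
    (ht : ∀ e, HasAllMoments (fun x => t x e) ν) (f : MatPoly n) (hf : f.totalDegree ≤ D) :
    (∫ p, MvPolynomial.eval (t p.1 + entries p.2) f ∂(ν.prod (nullLaw n))) ^ 2
      ≤ (∫ M, evalPoly f M ^ 2 ∂nullLaw n) * ∑ d ∈ Finset.range (D + 1),
        (∫ p, (∑ e, t p.1 e * t p.2 e) ^ d ∂(ν.prod ν)) / (d.factorial : ℝ) := by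
  obtain ⟨c, hc⟩ := exists_hermite_expansion f hf
  have hm : ∀ a, HasAllMoments
      (fun p : Ω × (RMat n × RMat n) => multiHermite a (t p.1 + entries p.2))
      (ν.prod (nullLaw n)) := fun a =>
    hasAllMoments_multiHermite (fun e =>
      ((ht e).comp_measurePreserving measurePreserving_fst).add
        ((hasAllMoments_entries n e).comp_measurePreserving measurePreserving_snd)) a
  have hP : ∫ p, MvPolynomial.eval (t p.1 + entries p.2) f ∂(ν.prod (nullLaw n))
      = ∑ a ∈ multiIdx _ D, c a * ∫ x, ∏ e, t x e ^ a e ∂ν := by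
    simp_rw [hc]
    rw [integral_finsetSum _ fun a _ => ((hm a).integrable.const_mul (c a))]
    refine Finset.sum_congr rfl fun a _ => ?_
    rw [integral_const_mul, integral_prod _ (hm a).integrable]
    simp only [integral_multiHermite_shift]
  have hQ : ∫ M, evalPoly f M ^ 2 ∂nullLaw n
      = ∑ a ∈ multiIdx _ D, c a ^ 2 * ∏ e, ((a e).factorial : ℝ) := by
    simp_rw [evalPoly_eq, hc]
    exact integral_sq_hermite_sum n D c
  rw [hP, hQ, ← sum_sq_moments_eq ν t ht]
  -- Cauchy–Schwarz, splitting the factor `a!` between the two sums.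
  refine Finset.sum_sq_le_sum_mul_sum_of_sq_le_mul _ ?_ ?_ ?_
  · intro a _; positivity
  · intro a _; positivity
  · intro a _
    have h1 : (∏ e, ((a e).factorial : ℝ)) ≠ 0 :=
      Finset.prod_ne_zero_iff.2 fun e _ => by positivity
    apply le_of_eq
    field_simp

end

noncomputable section

/-! ### Gaussian linearization -/

section GaussianLinearization

lemma integral_pow_even_stdGauss (d : ℕ) :
    (∫ x, x ^ (2 * d) ∂stdGauss) * (2 ^ d * d.factorial) = ((2 * d).factorial : ℝ) := by
  induction d with
  | zero => simp
  | succ d ih =>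
    have h := integral_mul_polynomial_stdGauss (Polynomial.X ^ (2 * d + 1))
    simp only [Polynomial.eval_pow, Polynomial.eval_X, Polynomial.derivative_X_pow,
      Polynomial.eval_mul, Polynomial.eval_C, add_tsub_cancel_right] at h
    rw [integral_const_mul] at h
    have e : ∀ x : ℝ, x ^ (2 * (d + 1)) = x * x ^ (2 * d + 1) := fun x => by ring
    simp_rw [e]
    rw [h, show 2 * (d + 1) = (2 * d + 1) + 1 by ring, Nat.factorial_succ, Nat.factorial_succ,
      Nat.factorial_succ]
    push_cast
    rw [← ih]
    ring

lemma map_linear_stdGauss (a b : ℝ) :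
    (stdGauss.prod stdGauss).map (fun g => g.1 * a + g.2 * b)
      = stdGauss.map fun x => x * √(a ^ 2 + b ^ 2) := by
  have h := gaussianReal_add_gaussianReal_of_indepFun
    (P := stdGauss.prod stdGauss) (X := fun g => g.1 * a) (Y := fun g => g.2 * b)
    (m₁ := 0) (m₂ := 0) (v₁ := ⟨a ^ 2, sq_nonneg a⟩) (v₂ := ⟨b ^ 2, sq_nonneg b⟩)
    (indepFun_prod (μ := stdGauss) (ν := stdGauss) (X := fun x => x * a) (Y := fun x => x * b)
      (by fun_prop) (by fun_prop)) ?_ ?_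
  · change (stdGauss.prod stdGauss).map ((fun g => g.1 * a) + fun g => g.2 * b) = _
    rw [h, gaussianReal_map_mul_const]
    congr 1
    · simp
    · ext
      simp only [mul_one, NNReal.coe_mk, Real.sq_sqrt (add_nonneg (sq_nonneg a) (sq_nonneg b))]
      rfl
  · have : (fun g : ℝ × ℝ => g.1 * a) = (fun x => x * a) ∘ Prod.fst := rfl
    rw [this, ← Measure.map_map (by fun_prop) (by fun_prop), measurePreserving_fst.map_eq,
      gaussianReal_map_mul_const]
    simp only [mul_zero, mul_one]
    rfl
  · have : (fun g : ℝ × ℝ => g.2 * b) = (fun x => x * b) ∘ Prod.snd := rfl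
    rw [this, ← Measure.map_map (by fun_prop) (by fun_prop), measurePreserving_snd.map_eq,
      gaussianReal_map_mul_const]
    simp only [mul_zero, mul_one]
    rfl

/-- Gaussian linearization of powers of a sum of two squares. -/
lemma pow_div_factorial_eq_gauss (a b : ℝ) (d : ℕ) :
    ((a ^ 2 + b ^ 2) / 2) ^ d / (d.factorial : ℝ)
      = (∫ g, (g.1 * a + g.2 * b) ^ (2 * d) ∂(stdGauss.prod stdGauss))
        / ((2 * d).factorial : ℝ) := by
  have h : ∫ g, (g.1 * a + g.2 * b) ^ (2 * d) ∂(stdGauss.prod stdGauss)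
      = ∫ y, y ^ (2 * d) ∂((stdGauss.prod stdGauss).map fun g => g.1 * a + g.2 * b) := by
    rw [integral_map (by fun_prop) (by fun_prop)]
  rw [h, map_linear_stdGauss, integral_map (by fun_prop) (by fun_prop)]
  simp_rw [mul_pow]
  rw [integral_mul_const, ← integral_pow_even_stdGauss d, pow_mul (√_),
    Real.sq_sqrt (add_nonneg (sq_nonneg a) (sq_nonneg b))]
  have : ∫ x, x ^ (2 * d) ∂stdGauss ≠ 0 := by
    intro h0
    have := integral_pow_even_stdGauss d
    rw [h0, zero_mul] at this
    exact absurd this.symm (by positivity)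
  rw [div_pow]
  field_simp

lemma integrable_exp_sq_stdGauss {t : ℝ} (ht : t < 1 / 2) :
    Integrable (fun x => Real.exp (t * x ^ 2)) stdGauss := by
  rw [stdGauss, gaussianReal_of_var_ne_zero _ one_ne_zero,
    integrable_withDensity_iff_integrable_smul' (measurable_gaussianPDF _ _)
      (ae_of_all _ fun _ => gaussianPDF_lt_top)]
  refine ((integrable_exp_neg_mul_sq (b := 1 / 2 - t) (by linarith)).const_mul
    (√(2 * Real.pi))⁻¹).congr (ae_of_all _ fun x => ?_)
  simp only [toReal_gaussianPDF, gaussianPDFReal_def, smul_eq_mul]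
  rw [mul_assoc, ← Real.exp_add]
  simp
  left; ring

end GaussianLinearization

/-! ### Exponential moments of the spike prior -/

section Prior

/-- A subgaussian variable has a finite exponential moment of its square. -/
lemma ProbabilityTheory.HasSubgaussianMGF.integrable_exp_mul_sq {Ω : Type*} [MeasurableSpace Ω]
    {μ : Measure Ω} [SFinite μ] {X : Ω → ℝ} (hX : Measurable X) {c : ℝ≥0}
    (h : HasSubgaussianMGF X c μ) {s : ℝ} (hs : 0 ≤ s) (hcs : 2 * c * s < 1) :
    Integrable (fun x => Real.exp (s * X x ^ 2)) μ := by
  refine ⟨by fun_prop, ?_⟩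
  rw [hasFiniteIntegral_iff_ofReal (ae_of_all _ fun _ => (Real.exp_pos _).le)]
  -- Linearize the square: `e^{sX²} = E_g e^{√(2s) X g}`. After exchanging the integrals, the
  -- subgaussian bound applies for each fixed `g` and leaves `E_g e^{c s g²}`, finite because `c s <
  -- 1/2`. Lower integrals allow the exchange before integrability is known.
  have e : ∀ x, ENNReal.ofReal (Real.exp (s * X x ^ 2))
      = ∫⁻ g, ENNReal.ofReal (Real.exp (√(2 * s) * X x * g)) ∂stdGauss := by
    intro x
    have h1 : ∫ g, Real.exp (√(2 * s) * X x * g) ∂stdGauss = Real.exp (s * X x ^ 2) := by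
      have := congrFun (mgf_id_gaussianReal (μ := 0) (v := 1)) (√(2 * s) * X x)
      simp only [mgf, id] at this
      rw [this, mul_pow, Real.sq_sqrt (by positivity)]
      congr 1; simp; ring
    rw [← h1, ofReal_integral_eq_lintegral_ofReal (integrable_exp_mul_gaussianReal _)
      (ae_of_all _ fun _ => (Real.exp_pos _).le)]
  simp_rw [e]
  rw [lintegral_lintegral_swap (by fun_prop)]
  calc _ ≤ ∫⁻ g, ENNReal.ofReal (Real.exp (c * s * g ^ 2)) ∂stdGauss := by
        refine lintegral_mono fun g => ?_
        have h2 := h.mgf_le (√(2 * s) * g)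
        have h3 := h.integrable_exp_mul (√(2 * s) * g)
        rw [mgf] at h2
        have e2 : ∀ x, √(2 * s) * X x * g = √(2 * s) * g * X x := fun x => by ring
        simp_rw [e2]
        rw [← ofReal_integral_eq_lintegral_ofReal h3 (ae_of_all _ fun _ => (Real.exp_pos _).le)]
        refine ENNReal.ofReal_le_ofReal (h2.trans_eq ?_)
        rw [mul_pow, Real.sq_sqrt (by positivity)]
        congr 1; ring
    _ < ⊤ := by
        have := (integrable_exp_sq_stdGauss (t := c * s) (by linarith)).2
        rwa [hasFiniteIntegral_iff_ofReal (ae_of_all _ fun _ => (Real.exp_pos _).le)] at this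

lemma Real.exp_le_taylor_two (z : ℝ) :
    Real.exp z ≤ 1 + z + z ^ 2 / 2 + |z| ^ 3 * Real.exp |z| := by
  have h := Complex.norm_exp_sub_sum_le_norm_mul_exp (z : ℂ) 3
  have e : Complex.exp z - ∑ m ∈ Finset.range 3, (z : ℂ) ^ m / (m.factorial : ℂ)
      = ((Real.exp z - (1 + z + z ^ 2 / 2) : ℝ) : ℂ) := by
    simp [Finset.sum_range_succ]
  rw [e, Complex.norm_real, Complex.norm_real, Real.norm_eq_abs, Real.norm_eq_abs] at h
  linarith [le_abs_self (Real.exp z - (1 + z + z ^ 2 / 2))]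

variable {rho : ℝ} {prior : Measure (ℝ × ℝ)}

lemma SpikePrior.hasAllMoments_fst (h : SpikePrior rho prior) :
    HasAllMoments (fun p : ℝ × ℝ => p.1) prior :=
  let ⟨_, hc, _⟩ := h.subgaussian; hc.hasAllMoments

lemma SpikePrior.hasAllMoments_snd (h : SpikePrior rho prior) :
    HasAllMoments (fun p : ℝ × ℝ => p.2) prior :=
  let ⟨_, _, hc⟩ := h.subgaussian; hc.hasAllMoments

/-- The two coordinates may be dependent, so `uv ≤ u² + v²` reduces to the marginals at the doubled
parameter `2s`; `s` is chosen to keep `2s` in the admissible range. -/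
lemma SpikePrior.exists_integrable_exp_sq (h : SpikePrior rho prior) :
    ∃ s : ℝ, 0 < s ∧ Integrable (fun p : ℝ × ℝ => Real.exp (s * (p.1 ^ 2 + p.2 ^ 2))) prior := by
  have := h.isProbabilityMeasure
  obtain ⟨c, h1, h2⟩ := h.subgaussian
  have hc : (0 : ℝ) ≤ c := c.2
  refine ⟨1 / (8 * (c + 1)), by positivity, ?_⟩
  set s : ℝ := 1 / (8 * (c + 1)) with hs
  have hs0 : 0 < s := by positivity
  have hcs : 2 * c * (2 * s) < 1 := by
    rw [hs]
    field_simp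
    linarith
  have i1 := h1.integrable_exp_mul_sq measurable_fst (s := 2 * s) (by positivity) hcs
  have i2 := h2.integrable_exp_mul_sq measurable_snd (s := 2 * s) (by positivity) hcs
  refine (i1.add i2).mono' (by fun_prop) (ae_of_all _ fun p => ?_)
  rw [Real.norm_eq_abs, abs_of_pos (Real.exp_pos _), mul_add, Real.exp_add]
  have e1 : Real.exp (2 * s * p.1 ^ 2) = Real.exp (s * p.1 ^ 2) ^ 2 := by
    rw [← Real.exp_nat_mul]; congr 1; push_cast; ring
  have e2 : Real.exp (2 * s * p.2 ^ 2) = Real.exp (s * p.2 ^ 2) ^ 2 := by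
    rw [← Real.exp_nat_mul]; congr 1; push_cast; ring
  simp only [Pi.add_apply, e1, e2]
  nlinarith [sq_nonneg (Real.exp (s * p.1 ^ 2) - Real.exp (s * p.2 ^ 2)),
    mul_pos (Real.exp_pos (s * p.1 ^ 2)) (Real.exp_pos (s * p.2 ^ 2))]

/-- The linear combination of coordinatewise products of two independent copies of a pair. -/
def pairForm (a b : ℝ) (q : (ℝ × ℝ) × (ℝ × ℝ)) : ℝ :=
  a * (q.1.1 * q.2.1) + b * (q.1.2 * q.2.2)

/-- A local bound for the moment generating function of the products of two independent copies
of a pair of spike coordinates. -/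
lemma SpikePrior.exists_mgf_bound (h : SpikePrior rho prior) :
    ∃ κ M : ℝ, 0 < κ ∧ 0 ≤ M ∧ ∀ a b r : ℝ, |a| ≤ r → |b| ≤ r → r ≤ κ →
      Integrable (fun q => Real.exp (pairForm a b q)) (prior.prod prior) ∧
      ∫ q, Real.exp (pairForm a b q) ∂(prior.prod prior)
        ≤ Real.exp ((a ^ 2 + b ^ 2 + 2 * rho ^ 2 * (a * b)) / 2 + r ^ 3 * M) := by
  have := h.isProbabilityMeasure
  obtain ⟨κ, hκ, hint⟩ := h.exists_integrable_exp_sq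
  set H : ℝ × ℝ → ℝ := fun p => Real.exp (κ * (p.1 ^ 2 + p.2 ^ 2)) with hH
  have hHH : Integrable (fun q : (ℝ × ℝ) × (ℝ × ℝ) => H q.1 * H q.2) (prior.prod prior) :=
    hint.mul_prod hint
  set M : ℝ := 6 / κ ^ 3 * ∫ q, H q.1 * H q.2 ∂(prior.prod prior) with hM
  have hM0 : 0 ≤ M := by
    have : 0 ≤ ∫ q, H q.1 * H q.2 ∂(prior.prod prior) :=
      integral_nonneg fun q => by positivity
    positivity
  refine ⟨κ, M, hκ, hM0, fun a b r ha hb hr => ?_⟩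
  have hr0 : 0 ≤ r := (abs_nonneg a).trans ha
  set S : (ℝ × ℝ) × (ℝ × ℝ) → ℝ := fun q => |q.1.1 * q.2.1| + |q.1.2 * q.2.2| with hS
  have hS0 : ∀ q, 0 ≤ S q := fun q => by positivity
  have hform : ∀ q, |pairForm a b q| ≤ r * S q := by
    intro q
    refine (abs_add_le _ _).trans ?_
    rw [abs_mul a, abs_mul b, hS, mul_add]
    gcongr
  have hSH : ∀ q, Real.exp (2 * (κ * S q)) ≤ H q.1 * H q.2 := by
    intro q
    rw [hH, ← Real.exp_add]
    refine Real.exp_le_exp.2 ?_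
    have h1 : ∀ x y : ℝ, 2 * |x * y| ≤ x ^ 2 + y ^ 2 := by
      intro x y
      rw [abs_mul]
      nlinarith [sq_nonneg (|x| - |y|), sq_abs x, sq_abs y]
    have h2 := h1 q.1.1 q.2.1
    have h3 := h1 q.1.2 q.2.2
    have : 2 * S q ≤ q.1.1 ^ 2 + q.1.2 ^ 2 + (q.2.1 ^ 2 + q.2.2 ^ 2) := by
      simp only [hS]; linarith
    nlinarith
  have hrem : ∀ q, |pairForm a b q| ^ 3 * Real.exp |pairForm a b q|
      ≤ r ^ 3 * (6 / κ ^ 3 * (H q.1 * H q.2)) := by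
    intro q
    -- Half of the exponential budget `e^{2κS}` absorbs the cube, the other half the Taylor factor
    -- `e^{κS}`. This is the origin of `6 / κ³` in `M`.
    have h1 : (κ * S q) ^ 3 ≤ 6 * Real.exp (κ * S q) := by
      have := Real.pow_div_factorial_le_exp (x := κ * S q) (by have := hS0 q; positivity) 3
      rw [div_le_iff₀ (by positivity)] at this
      refine this.trans_eq ?_
      simp [Nat.factorial]; ring
    have h2 : |pairForm a b q| ≤ κ * S q := (hform q).trans (by have := hS0 q; gcongr)
    calc _ ≤ (r * S q) ^ 3 * Real.exp (κ * S q) := by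
          gcongr
          exact hform q
      _ = r ^ 3 * (1 / κ ^ 3 * ((κ * S q) ^ 3 * Real.exp (κ * S q))) := by
          field_simp
      _ ≤ r ^ 3 * (1 / κ ^ 3 * ((6 * Real.exp (κ * S q)) * Real.exp (κ * S q))) := by
          gcongr
      _ = r ^ 3 * (6 / κ ^ 3 * Real.exp (2 * (κ * S q))) := by
          rw [two_mul, Real.exp_add]; ring
      _ ≤ _ := by gcongr; exact hSH q
  have hmeas : Measurable (pairForm a b) := by unfold pairForm; fun_prop
  have hexp : Integrable (fun q => Real.exp (pairForm a b q)) (prior.prod prior) := by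
    refine hHH.mono' (by fun_prop) (ae_of_all _ fun q => ?_)
    rw [Real.norm_eq_abs, abs_of_pos (Real.exp_pos _)]
    refine le_trans (Real.exp_le_exp.2 ?_) (hSH q)
    have h1 := le_abs_self (pairForm a b q)
    have h2 := hform q
    have h3 : r * S q ≤ κ * S q := by have := hS0 q; gcongr
    have h4 : 0 ≤ κ * S q := by have := hS0 q; positivity
    linarith
  refine ⟨hexp, ?_⟩
  have m1 : HasAllMoments (fun q : (ℝ × ℝ) × (ℝ × ℝ) => q.1.1 * q.2.1) (prior.prod prior) :=
    (h.hasAllMoments_fst.comp_measurePreserving measurePreserving_fst).mul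
      (h.hasAllMoments_fst.comp_measurePreserving measurePreserving_snd)
  have m2 : HasAllMoments (fun q : (ℝ × ℝ) × (ℝ × ℝ) => q.1.2 * q.2.2) (prior.prod prior) :=
    (h.hasAllMoments_snd.comp_measurePreserving measurePreserving_fst).mul
      (h.hasAllMoments_snd.comp_measurePreserving measurePreserving_snd)
  have mz : HasAllMoments (pairForm a b) (prior.prod prior) :=
    ((HasAllMoments.const a).mul m1).add ((HasAllMoments.const b).mul m2)
  have z1 : ∫ q, pairForm a b q ∂(prior.prod prior) = 0 := by
    unfold pairForm
    rw [integral_add (m1.integrable.const_mul a) (m2.integrable.const_mul b), integral_const_mul,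
      integral_const_mul, integral_prod_mul (fun p : ℝ × ℝ => p.1) (fun p : ℝ × ℝ => p.1),
      integral_prod_mul (fun p : ℝ × ℝ => p.2) (fun p : ℝ × ℝ => p.2), h.mean_fst, h.mean_snd]
    simp
  -- The cross term is `E[𝕏𝕐]²`, one factor per copy, hence `ρ²`.
  have z2 : ∫ q, pairForm a b q ^ 2 ∂(prior.prod prior)
      = a ^ 2 + b ^ 2 + 2 * rho ^ 2 * (a * b) := by
    have e : ∀ q, pairForm a b q ^ 2 = a ^ 2 * (q.1.1 ^ 2 * q.2.1 ^ 2)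
        + b ^ 2 * (q.1.2 ^ 2 * q.2.2 ^ 2) + 2 * (a * b) * ((q.1.1 * q.1.2) * (q.2.1 * q.2.2)) := by
      intro q; unfold pairForm; ring
    have i1 : Integrable (fun q : (ℝ × ℝ) × (ℝ × ℝ) => a ^ 2 * (q.1.1 ^ 2 * q.2.1 ^ 2))
        (prior.prod prior) := by
      simpa only [mul_pow] using ((m1.pow 2).integrable.const_mul (a ^ 2))
    have i2 : Integrable (fun q : (ℝ × ℝ) × (ℝ × ℝ) => b ^ 2 * (q.1.2 ^ 2 * q.2.2 ^ 2))
        (prior.prod prior) := by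
      simpa only [mul_pow] using ((m2.pow 2).integrable.const_mul (b ^ 2))
    have i3 : Integrable (fun q : (ℝ × ℝ) × (ℝ × ℝ) =>
        2 * (a * b) * ((q.1.1 * q.1.2) * (q.2.1 * q.2.2))) (prior.prod prior) :=
      (m1.mul m2).integrable.const_mul (2 * (a * b)) |>.congr (ae_of_all _ fun q => by ring)
    have i12 : Integrable (fun q : (ℝ × ℝ) × (ℝ × ℝ) => a ^ 2 * (q.1.1 ^ 2 * q.2.1 ^ 2)
        + b ^ 2 * (q.1.2 ^ 2 * q.2.2 ^ 2)) (prior.prod prior) := i1.add i2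
    simp_rw [e]
    rw [integral_add i12 i3, integral_add i1 i2, integral_const_mul, integral_const_mul,
      integral_const_mul, integral_prod_mul (fun p : ℝ × ℝ => p.1 ^ 2) (fun p : ℝ × ℝ => p.1 ^ 2),
      integral_prod_mul (fun p : ℝ × ℝ => p.2 ^ 2) (fun p : ℝ × ℝ => p.2 ^ 2),
      integral_prod_mul (fun p : ℝ × ℝ => p.1 * p.2) (fun p : ℝ × ℝ => p.1 * p.2),
      h.sq_fst, h.sq_snd, h.cross]
    ring
  have iz := mz.integrable
  have iz2 := ((mz.pow 2).integrable).div_const 2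
  have iR := (hHH.const_mul (6 / κ ^ 3)).const_mul (r ^ 3)
  have i1 : Integrable (fun q => 1 + pairForm a b q) (prior.prod prior) :=
    (integrable_const 1).add iz
  have i2 : Integrable (fun q => 1 + pairForm a b q + pairForm a b q ^ 2 / 2) (prior.prod prior) :=
    i1.add iz2
  calc ∫ q, Real.exp (pairForm a b q) ∂(prior.prod prior)
      ≤ ∫ q, (1 + pairForm a b q + pairForm a b q ^ 2 / 2
          + r ^ 3 * (6 / κ ^ 3 * (H q.1 * H q.2))) ∂(prior.prod prior) :=
        integral_mono hexp (i2.add iR) fun q =>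
          (Real.exp_le_taylor_two _).trans (add_le_add_right (hrem q) _)
    _ = (a ^ 2 + b ^ 2 + 2 * rho ^ 2 * (a * b)) / 2 + r ^ 3 * M + 1 := by
        rw [integral_add i2 iR, integral_add i1 iz2, integral_add (integrable_const 1) iz, z1,
          integral_div, z2, integral_const_mul, integral_const_mul]
        simp [hM]; ring
    _ ≤ _ := Real.add_one_le_exp _

end Prior

end

noncomputable section

/-! ### Overlaps of two samples and truncated cosh moments -/

section Spikes

variable {n : ℕ}

/-- All entries of the two spikes. -/
def spikeVec (lam mu : ℝ) (w : Fin n → ℝ × ℝ) : EntryIdx n → ℝ :=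
  entries (spike lam fun i => (w i).1, spike mu fun i => (w i).2)

/-- The overlap form `∑ᵢ (a xᵢ xᵢ' + b yᵢ yᵢ')` of two samples. -/
def overlapForm (a b : ℝ) (q : (Fin n → ℝ × ℝ) × (Fin n → ℝ × ℝ)) : ℝ :=
  ∑ i, pairForm a b (q.1 i, q.2 i)

lemma overlapForm_eq (a b : ℝ) (q : (Fin n → ℝ × ℝ) × (Fin n → ℝ × ℝ)) :
    overlapForm a b q
      = a * ∑ i, (q.1 i).1 * (q.2 i).1 + b * ∑ i, (q.1 i).2 * (q.2 i).2 := by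
  simp only [overlapForm, pairForm, Finset.sum_add_distrib, Finset.mul_sum]

lemma overlapForm_smul (c a b : ℝ) (q : (Fin n → ℝ × ℝ) × (Fin n → ℝ × ℝ)) :
    overlapForm (c * a) (c * b) q = c * overlapForm a b q := by
  simp only [overlapForm_eq]; ring

/-- `⟨vvᵀ, wwᵀ⟩ = ⟨v, w⟩²`. The normalization `√(2n)` leaves the factor `1/2` that Gaussian
linearization requires. -/
lemma sum_spike_mul_spike (s : ℝ) (v w : Fin n → ℝ) :
    ∑ e : Fin n × Fin n, spike s v e.1 e.2 * spike s w e.1 e.2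
      = (s / √n * ∑ i, v i * w i) ^ 2 / 2 := by
  have h : ∀ e : Fin n × Fin n, spike s v e.1 e.2 * spike s w e.1 e.2
      = s ^ 2 / (2 * n) * ((v e.1 * w e.1) * (v e.2 * w e.2)) := by
    intro e
    have hq : √(2 * (n : ℝ)) ^ 2 = 2 * n := Real.sq_sqrt (by positivity)
    calc _ = s ^ 2 / √(2 * (n : ℝ)) ^ 2 * ((v e.1 * w e.1) * (v e.2 * w e.2)) := by
          rw [spike, spike]; ring
      _ = _ := by rw [hq]
  simp_rw [h]
  rw [← Finset.mul_sum, Fintype.sum_prod_type, mul_pow, div_pow, Real.sq_sqrt (by positivity), sq,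
    sq (∑ i, v i * w i), Finset.sum_mul_sum]
  ring

lemma sum_spikeVec_mul (lam mu : ℝ) (q : (Fin n → ℝ × ℝ) × (Fin n → ℝ × ℝ)) :
    ∑ e, spikeVec lam mu q.1 e * spikeVec lam mu q.2 e
      = ((lam / √n * ∑ i, (q.1 i).1 * (q.2 i).1) ^ 2
        + (mu / √n * ∑ i, (q.1 i).2 * (q.2 i).2) ^ 2) / 2 := by
  rw [Fintype.sum_sum_type]
  simp only [spikeVec, entries, Sum.elim_inl, Sum.elim_inr]
  rw [sum_spike_mul_spike, sum_spike_mul_spike]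
  ring

variable {rho : ℝ} {prior : Measure (ℝ × ℝ)}

lemma SpikePrior.hasAllMoments_coord_fst (h : SpikePrior rho prior) (i : Fin n) :
    HasAllMoments (fun w : Fin n → ℝ × ℝ => (w i).1) (Measure.pi fun _ => prior) :=
  have := h.isProbabilityMeasure
  h.hasAllMoments_fst.comp_measurePreserving (measurePreserving_eval (fun _ : Fin n => prior) i)

lemma SpikePrior.hasAllMoments_coord_snd (h : SpikePrior rho prior) (i : Fin n) :
    HasAllMoments (fun w : Fin n → ℝ × ℝ => (w i).2) (Measure.pi fun _ => prior) :=
  have := h.isProbabilityMeasure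
  h.hasAllMoments_snd.comp_measurePreserving (measurePreserving_eval (fun _ : Fin n => prior) i)

lemma SpikePrior.hasAllMoments_spikeVec (h : SpikePrior rho prior) (lam mu : ℝ) (e : EntryIdx n) :
    HasAllMoments (fun w : Fin n → ℝ × ℝ => spikeVec lam mu w e) (Measure.pi fun _ => prior) := by
  have := h.isProbabilityMeasure
  rcases e with e | e
  · exact (HasAllMoments.const _).mul
      ((h.hasAllMoments_coord_fst e.1).mul (h.hasAllMoments_coord_fst e.2))
  · exact (HasAllMoments.const _).mul
      ((h.hasAllMoments_coord_snd e.1).mul (h.hasAllMoments_coord_snd e.2))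

lemma measurable_evalPoly (f : MatPoly n) : Measurable (evalPoly f) := by
  have : evalPoly f = fun M => ∑ d ∈ f.support, f.coeff d * ∏ e, entries M e ^ d e := by
    ext M; rw [evalPoly_eq, MvPolynomial.eval_eq']
  rw [this]
  refine Finset.measurable_sum _ fun d _ => Measurable.const_mul ?_ _
  refine Finset.measurable_prod _ fun e _ => Measurable.pow_const ?_ _
  rcases e with e | e <;> simp only [entries, Sum.elim_inl, Sum.elim_inr] <;> fun_prop

lemma measurable_spike_comp (s : ℝ) {Ω : Type*} [MeasurableSpace Ω] {v : Ω → Fin n → ℝ}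
    (hv : ∀ i, Measurable fun x => v x i) : Measurable fun x => spike s (v x) := by
  unfold spike
  refine measurable_pi_lambda _ fun i => measurable_pi_lambda _ fun j => ?_
  exact ((hv i).mul (hv j)).const_mul _

lemma measurable_plantedMap (lam mu : ℝ) :
    Measurable fun ω : (Fin n → ℝ × ℝ) × (RMat n × RMat n) =>
      (spike lam (fun i => (ω.1 i).1) + ω.2.1, spike mu (fun i => (ω.1 i).2) + ω.2.2) := by
  refine Measurable.prodMk ?_ ?_
  · exact (measurable_spike_comp lam fun i => by fun_prop).add (by fun_prop)
  · exact (measurable_spike_comp mu fun i => by fun_prop).add (by fun_prop)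

lemma integral_plantedLaw (lam mu : ℝ) (prior : Measure (ℝ × ℝ)) (f : MatPoly n) :
    ∫ M, evalPoly f M ∂plantedLaw lam mu prior n
      = ∫ p, MvPolynomial.eval (spikeVec lam mu p.1 + entries p.2) f
        ∂((Measure.pi fun _ => prior).prod (nullLaw n)) := by
  rw [plantedLaw, integral_map (measurable_plantedMap lam mu).aemeasurable
    (measurable_evalPoly f).aestronglyMeasurable]
  refine integral_congr_ae (ae_of_all _ fun p => ?_)
  simp only [evalPoly_eq]
  congr 2
  ext e
  rcases e with e | e <;> rfl

/-- The squared degree-`D` advantage, expressed through the overlap of two samples. -/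
def overlapSum (lam mu : ℝ) (prior : Measure (ℝ × ℝ)) (n D : ℕ) : ℝ :=
  ∑ d ∈ Finset.range (D + 1),
    (∫ p, (∑ e, spikeVec lam mu p.1 e * spikeVec lam mu p.2 e) ^ d
      ∂((Measure.pi fun _ : Fin n => prior).prod (Measure.pi fun _ => prior))) / (d.factorial : ℝ)

lemma SpikePrior.sq_integral_plantedLaw_le (h : SpikePrior rho prior) (lam mu : ℝ) {D : ℕ}
    (f : MatPoly n) (hf : f.totalDegree ≤ D) :
    (∫ M, evalPoly f M ∂plantedLaw lam mu prior n) ^ 2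
      ≤ (∫ M, evalPoly f M ^ 2 ∂nullLaw n) * overlapSum lam mu prior n D := by
  have := h.isProbabilityMeasure
  rw [integral_plantedLaw]
  exact sq_integral_shift_le n D _ _ (h.hasAllMoments_spikeVec lam mu) f hf

/-- A pair of `n`-samples regroups into `n` independent pairs, over which the exponential
factorizes. -/
lemma SpikePrior.integrable_exp_overlapForm (h : SpikePrior rho prior) {a b : ℝ}
    (hab : Integrable (fun q => Real.exp (pairForm a b q)) (prior.prod prior)) :
    Integrable (fun q : (Fin n → ℝ × ℝ) × (Fin n → ℝ × ℝ) => Real.exp (overlapForm a b q))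
      ((Measure.pi fun _ => prior).prod (Measure.pi fun _ => prior)) ∧
    ∫ q : (Fin n → ℝ × ℝ) × (Fin n → ℝ × ℝ), Real.exp (overlapForm a b q)
      ∂((Measure.pi fun _ => prior).prod (Measure.pi fun _ => prior))
      = (∫ q, Real.exp (pairForm a b q) ∂(prior.prod prior)) ^ n := by
  have := h.isProbabilityMeasure
  have hmp := measurePreserving_arrowProdEquivProdArrow (ℝ × ℝ) (ℝ × ℝ) (Fin n)
    (fun _ => prior) (fun _ => prior)
  have e : ∀ x : Fin n → (ℝ × ℝ) × (ℝ × ℝ),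
      Real.exp (overlapForm a b (MeasurableEquiv.arrowProdEquivProdArrow (ℝ × ℝ) (ℝ × ℝ) (Fin n) x))
        = ∏ i, Real.exp (pairForm a b (x i)) := by
    intro x
    rw [overlapForm, Real.exp_sum]
    rfl
  constructor
  · rw [← hmp.integrable_comp_emb (MeasurableEquiv.measurableEmbedding _)]
    simp only [Function.comp_def, e]
    exact Integrable.fintype_prod (μ := fun _ : Fin n => prior.prod prior) fun _ => hab
  · rw [← hmp.integral_comp']
    simp_rw [e]
    rw [integral_fintype_prod_eq_pow (fun q => Real.exp (pairForm a b q)), Fintype.card_fin]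

/-- The truncated hyperbolic cosine moment of the overlap form. -/
def truncCosh (prior : Measure (ℝ × ℝ)) (n D : ℕ) (a b : ℝ) : ℝ :=
  ∑ d ∈ Finset.range (D + 1),
    (∫ q : (Fin n → ℝ × ℝ) × (Fin n → ℝ × ℝ), overlapForm a b q ^ (2 * d)
      ∂((Measure.pi fun _ => prior).prod (Measure.pi fun _ => prior))) / ((2 * d).factorial : ℝ)

lemma SpikePrior.hasAllMoments_overlap_fst (h : SpikePrior rho prior) :
    HasAllMoments (fun q : (Fin n → ℝ × ℝ) × (Fin n → ℝ × ℝ) => ∑ i, (q.1 i).1 * (q.2 i).1)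
      ((Measure.pi fun _ => prior).prod (Measure.pi fun _ => prior)) := by
  have := h.isProbabilityMeasure
  exact HasAllMoments.sum _ fun i _ =>
    ((h.hasAllMoments_coord_fst i).comp_measurePreserving measurePreserving_fst).mul
      ((h.hasAllMoments_coord_fst i).comp_measurePreserving measurePreserving_snd)

lemma SpikePrior.hasAllMoments_overlap_snd (h : SpikePrior rho prior) :
    HasAllMoments (fun q : (Fin n → ℝ × ℝ) × (Fin n → ℝ × ℝ) => ∑ i, (q.1 i).2 * (q.2 i).2)
      ((Measure.pi fun _ => prior).prod (Measure.pi fun _ => prior)) := by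
  have := h.isProbabilityMeasure
  exact HasAllMoments.sum _ fun i _ =>
    ((h.hasAllMoments_coord_snd i).comp_measurePreserving measurePreserving_fst).mul
      ((h.hasAllMoments_coord_snd i).comp_measurePreserving measurePreserving_snd)

lemma SpikePrior.hasAllMoments_overlapForm (h : SpikePrior rho prior) (a b : ℝ) :
    HasAllMoments (overlapForm (n := n) a b)
      ((Measure.pi fun _ => prior).prod (Measure.pi fun _ => prior)) := by
  have := h.isProbabilityMeasure
  rw [funext (overlapForm_eq a b)]
  exact ((HasAllMoments.const a).mul h.hasAllMoments_overlap_fst).add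
    ((HasAllMoments.const b).mul h.hasAllMoments_overlap_snd)

/-- The overlap sum is a Gaussian average of truncated hyperbolic cosine moments. -/
lemma SpikePrior.overlapSum_eq (h : SpikePrior rho prior) (lam mu : ℝ) (n D : ℕ) :
    Integrable (fun g : ℝ × ℝ => truncCosh prior n D (g.1 * (lam / √n)) (g.2 * (mu / √n)))
      (stdGauss.prod stdGauss) ∧
    overlapSum lam mu prior n D
      = ∫ g, truncCosh prior n D (g.1 * (lam / √n)) (g.2 * (mu / √n))
        ∂(stdGauss.prod stdGauss) := by
  have := h.isProbabilityMeasure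
  set ν : Measure ((Fin n → ℝ × ℝ) × (Fin n → ℝ × ℝ)) :=
    (Measure.pi fun _ => prior).prod (Measure.pi fun _ => prior) with hν
  have hm : HasAllMoments (fun z : (ℝ × ℝ) × ((Fin n → ℝ × ℝ) × (Fin n → ℝ × ℝ)) =>
      overlapForm (z.1.1 * (lam / √n)) (z.1.2 * (mu / √n)) z.2)
      ((stdGauss.prod stdGauss).prod ν) := by
    simp only [overlapForm_eq]
    have g1 : HasAllMoments (fun z : (ℝ × ℝ) × ((Fin n → ℝ × ℝ) × (Fin n → ℝ × ℝ)) => z.1.1)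
        ((stdGauss.prod stdGauss).prod ν) :=
      hasAllMoments_id_stdGauss.comp_measurePreserving
        (measurePreserving_fst.comp measurePreserving_fst)
    have g2 : HasAllMoments (fun z : (ℝ × ℝ) × ((Fin n → ℝ × ℝ) × (Fin n → ℝ × ℝ)) => z.1.2)
        ((stdGauss.prod stdGauss).prod ν) :=
      hasAllMoments_id_stdGauss.comp_measurePreserving
        (measurePreserving_snd.comp measurePreserving_fst)
    exact ((g1.mul (HasAllMoments.const _)).mul
        (h.hasAllMoments_overlap_fst.comp_measurePreserving measurePreserving_snd)).add
      ((g2.mul (HasAllMoments.const _)).mul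
        (h.hasAllMoments_overlap_snd.comp_measurePreserving measurePreserving_snd))
  have hi : ∀ d, Integrable (fun z : (ℝ × ℝ) × ((Fin n → ℝ × ℝ) × (Fin n → ℝ × ℝ)) =>
      overlapForm (z.1.1 * (lam / √n)) (z.1.2 * (mu / √n)) z.2 ^ (2 * d))
      ((stdGauss.prod stdGauss).prod ν) := fun d => (hm.pow _).integrable
  have hterm : ∀ d ∈ Finset.range (D + 1), Integrable (fun g : ℝ × ℝ =>
      (∫ q, overlapForm (g.1 * (lam / √n)) (g.2 * (mu / √n)) q ^ (2 * d) ∂ν)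
        / ((2 * d).factorial : ℝ)) (stdGauss.prod stdGauss) :=
    fun d _ => (hi d).integral_prod_left.div_const _
  refine ⟨integrable_finsetSum _ hterm, ?_⟩
  unfold truncCosh
  rw [overlapSum, integral_finsetSum _ hterm]
  refine Finset.sum_congr rfl fun d _ => ?_
  rw [integral_div, integral_integral_swap (hi d), ← integral_div, ← integral_div]
  refine integral_congr_ae (ae_of_all _ fun q => ?_)
  simp only [sum_spikeVec_mul]
  rw [pow_div_factorial_eq_gauss]
  congr 1
  refine integral_congr_ae (ae_of_all _ fun g => ?_)
  simp only [overlapForm_eq]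
  ring

/-- All terms of the cosh series are nonnegative, so truncation only decreases it; the full cosh is
the mean of the exponentials at `(a, b)` and `(-a, -b)`. -/
lemma SpikePrior.truncCosh_le (h : SpikePrior rho prior) (n D : ℕ) {a b B : ℝ}
    (h1 : Integrable (fun q => Real.exp (pairForm a b q)) (prior.prod prior))
    (h2 : Integrable (fun q => Real.exp (pairForm (-a) (-b) q)) (prior.prod prior))
    (b1 : ∫ q, Real.exp (pairForm a b q) ∂(prior.prod prior) ≤ B)
    (b2 : ∫ q, Real.exp (pairForm (-a) (-b) q) ∂(prior.prod prior) ≤ B) :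
    truncCosh prior n D a b ≤ B ^ n := by
  have := h.isProbabilityMeasure
  obtain ⟨i1, e1⟩ := h.integrable_exp_overlapForm (n := n) h1
  obtain ⟨i2, e2⟩ := h.integrable_exp_overlapForm (n := n) h2
  have hn : ∀ q : (Fin n → ℝ × ℝ) × (Fin n → ℝ × ℝ),
      overlapForm (-a) (-b) q = -overlapForm a b q := fun q => by
    simp only [overlapForm_eq]; ring
  simp_rw [hn] at i2 e2
  have hi := fun d : ℕ => ((h.hasAllMoments_overlapForm (n := n) a b).pow (2 * d)).integrable
  unfold truncCosh
  simp_rw [← integral_div]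
  rw [← integral_finsetSum _ fun d _ => (hi d).div_const _]
  have hp1 : 0 ≤ ∫ q, Real.exp (pairForm a b q) ∂(prior.prod prior) :=
    integral_nonneg fun _ => (Real.exp_pos _).le
  have hp2 : 0 ≤ ∫ q, Real.exp (pairForm (-a) (-b) q) ∂(prior.prod prior) :=
    integral_nonneg fun _ => (Real.exp_pos _).le
  calc _ ≤ ∫ q : (Fin n → ℝ × ℝ) × (Fin n → ℝ × ℝ),
        (Real.exp (overlapForm a b q) + Real.exp (-overlapForm a b q)) / 2
          ∂((Measure.pi fun _ => prior).prod (Measure.pi fun _ => prior)) := by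
        refine integral_mono (integrable_finsetSum _ fun d _ => (hi d).div_const _)
          ((i1.add i2).div_const 2) fun q => ?_
        rw [← Real.cosh_eq]
        refine sum_le_hasSum _ (fun d _ => ?_) (Real.hasSum_cosh _)
        have : 0 ≤ overlapForm a b q ^ (2 * d) := by rw [pow_mul]; positivity
        positivity
    _ ≤ B ^ n := by
        rw [integral_div, integral_add i1 i2, e1, e2]
        have := pow_le_pow_left₀ hp1 b1 n
        have := pow_le_pow_left₀ hp2 b2 n
        linarith

/-- Each term is nonnegative and homogeneous of degree `2d ≤ 2D`. This polynomial growth replaces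
the generating function bound outside its range. -/
lemma truncCosh_scale_le (prior : Measure (ℝ × ℝ)) (n D : ℕ) (a b : ℝ) {t : ℝ} (ht : 1 ≤ t) :
    truncCosh prior n D (t * a) (t * b) ≤ (t ^ 2) ^ D * truncCosh prior n D a b := by
  unfold truncCosh
  rw [Finset.mul_sum]
  refine Finset.sum_le_sum fun d hd => ?_
  simp_rw [overlapForm_smul, mul_pow]
  rw [integral_const_mul, mul_div_assoc, pow_mul t]
  have : 0 ≤ ∫ q : (Fin n → ℝ × ℝ) × (Fin n → ℝ × ℝ), overlapForm a b q ^ (2 * d)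
      ∂((Measure.pi fun _ => prior).prod (Measure.pi fun _ => prior)) :=
    integral_nonneg fun q => by
      simp only [pow_mul]; positivity
  gcongr
  · nlinarith
  · exact Nat.lt_succ_iff.1 (Finset.mem_range.1 hd)

end Spikes

/-! ### The threshold as positive definiteness -/

/-- Below the threshold, the quadratic form of the limiting overlap is strictly smaller than the
Euclidean one. -/
lemma exists_gap_of_thresholdF_lt {lam mu rho eps : ℝ} (heps : 0 < eps)
    (hF : thresholdF lam mu rho 1 < 1 - eps) :
    lam ^ 2 < 1 ∧ mu ^ 2 < 1 ∧ ∃ δ : ℝ, 0 < δ ∧ 2 * δ ≤ 1 ∧ ∀ x y : ℝ,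
      lam ^ 2 * x ^ 2 + mu ^ 2 * y ^ 2 + 2 * rho ^ 2 * ((lam * x) * (mu * y))
        ≤ (1 - 2 * δ) * (x ^ 2 + y ^ 2) := by
  rw [thresholdF, max_lt_iff, max_lt_iff, div_one, div_one] at hF
  obtain ⟨h1, h2, h3⟩ := hF
  have hl : lam ^ 2 < 1 := by linarith
  have hm : mu ^ 2 < 1 := by linarith
  refine ⟨hl, hm, ?_⟩
  set A := 1 - lam ^ 2 with hA
  set C := 1 - mu ^ 2 with hC
  have hA0 : 0 < A := by linarith
  have hC0 : 0 < C := by linarith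
  set p := lam ^ 2 * rho ^ 2 with hp
  set q := mu ^ 2 * rho ^ 2 with hq
  have hp0 : 0 ≤ p := by positivity
  have hq0 : 0 ≤ q := by positivity
  have h4 : p / (A + p) + q / (C + q) < 1 := by linarith
  -- Clearing denominators, `p(C+q) + q(A+p) < (A+p)(C+q)` is exactly `pq < AC`: the matrix with
  -- diagonal `A, C` and off-diagonal `-b` has positive determinant.
  have hb : p * q < A * C := by
    rw [div_add_div _ _ (by positivity) (by positivity), div_lt_one (by positivity)] at h4
    nlinarith
  set b := lam * mu * rho ^ 2 with hb'
  have hb2 : b ^ 2 < A * C := by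
    have : b ^ 2 = p * q := by rw [hb', hp, hq]; ring
    rwa [this]
  -- `2δ` is determinant over trace, a lower bound for the smallest eigenvalue.
  refine ⟨(A * C - b ^ 2) / (2 * (A + C)), div_pos (by linarith) (by positivity), ?_, ?_⟩
  · rw [← mul_div_assoc, div_le_one (by positivity)]
    have : C ≤ 1 := by rw [hC]; linarith [sq_nonneg mu]
    nlinarith [sq_nonneg b]
  · intro x y
    set δ := (A * C - b ^ 2) / (2 * (A + C)) with hδ
    have hδe : 2 * δ * (A + C) = A * C - b ^ 2 := by rw [hδ]; field_simp
    have hδ0 : 0 < δ := div_pos (by linarith) (by positivity)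
    have hAδ : 0 < A - 2 * δ := by
      have : 0 < (A - 2 * δ) * (A + C) := by nlinarith [sq_nonneg b]
      exact pos_of_mul_pos_left this (by positivity)
    -- The difference of the two sides is exactly `4δ²`.
    have hdet : b ^ 2 ≤ (A - 2 * δ) * (C - 2 * δ) := by nlinarith
    have key : 0 ≤ (A - 2 * δ) * x ^ 2 + (C - 2 * δ) * y ^ 2 - 2 * b * (x * y) := by
      have : 0 ≤ (A - 2 * δ) * ((A - 2 * δ) * x ^ 2 + (C - 2 * δ) * y ^ 2 - 2 * b * (x * y)) := by
        nlinarith [sq_nonneg ((A - 2 * δ) * x - b * y), mul_le_mul_of_nonneg_right hdet (sq_nonneg y)]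
      exact nonneg_of_mul_nonneg_right this hAδ
    have e : (1 - 2 * δ) * (x ^ 2 + y ^ 2) -
        (lam ^ 2 * x ^ 2 + mu ^ 2 * y ^ 2 + 2 * rho ^ 2 * ((lam * x) * (mu * y)))
        = (A - 2 * δ) * x ^ 2 + (C - 2 * δ) * y ^ 2 - 2 * b * (x * y) := by
      rw [hA, hC, hb']; ring
    linarith

end

/-! ### Bounding the advantage and excluding separation -/

noncomputable section

/-- The constant bounding the advantage when the spectral gap of the quadratic form is `δ`. -/
def advantageBound (δ : ℝ) : ℝ := ∫ x, Real.exp ((1 - δ) / 2 * x ^ 2) ∂stdGauss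

lemma advantageBound_nonneg (δ : ℝ) : 0 ≤ advantageBound δ :=
  integral_nonneg fun _ => (Real.exp_pos _).le

lemma integral_exp_sq_prod (δ : ℝ) (hδ : 0 < δ) :
    Integrable (fun g : ℝ × ℝ => Real.exp ((1 - δ) / 2 * (g.1 ^ 2 + g.2 ^ 2)))
      (stdGauss.prod stdGauss) ∧
    ∫ g : ℝ × ℝ, Real.exp ((1 - δ) / 2 * (g.1 ^ 2 + g.2 ^ 2)) ∂(stdGauss.prod stdGauss)
      = advantageBound δ ^ 2 := by
  have h := integrable_exp_sq_stdGauss (t := (1 - δ) / 2) (by linarith)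
  simp only [mul_add, Real.exp_add]
  refine ⟨h.mul_prod h, ?_⟩
  rw [sq]
  exact integral_prod_mul (fun x : ℝ => Real.exp ((1 - δ) / 2 * x ^ 2))
    fun x : ℝ => Real.exp ((1 - δ) / 2 * x ^ 2)

variable {rho : ℝ} {prior : Measure (ℝ × ℝ)}

/-- In the local range the truncated hyperbolic cosine moments are subgaussian. -/
lemma SpikePrior.exists_truncCosh_le_local (h : SpikePrior rho prior) {lam mu δ : ℝ}
    (hl : lam ^ 2 < 1) (hm : mu ^ 2 < 1) (hδ : 0 < δ)
    (hq : ∀ x y : ℝ, lam ^ 2 * x ^ 2 + mu ^ 2 * y ^ 2 + 2 * rho ^ 2 * ((lam * x) * (mu * y))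
      ≤ (1 - 2 * δ) * (x ^ 2 + y ^ 2)) :
    ∃ κ : ℝ, 0 < κ ∧ ∀ n D : ℕ, 0 < n → ∀ x y : ℝ, x ^ 2 + y ^ 2 ≤ κ ^ 2 * n →
      truncCosh prior n D (x * (lam / √n)) (y * (mu / √n))
        ≤ Real.exp ((1 - δ) / 2 * (x ^ 2 + y ^ 2)) := by
  obtain ⟨κ₀, M, hκ₀, hM, hb⟩ := h.exists_mgf_bound
  -- The first entry keeps the generating function bound valid. The second gives `rM ≤ δ/2`, so the
  -- cubic error `n r³ M = s · rM` costs half of the gap and `1 - 2δ` becomes `1 - δ`.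
  refine ⟨min κ₀ (δ / (2 * (M + 1))), lt_min hκ₀ (by positivity), fun n D hn x y hxy => ?_⟩
  set κ := min κ₀ (δ / (2 * (M + 1))) with hκ
  have hκ0 : 0 < κ := lt_min hκ₀ (by positivity)
  have hn0 : (0 : ℝ) < n := by exact_mod_cast hn
  have hsn : 0 < √(n : ℝ) := Real.sqrt_pos.2 hn0
  have hsn2 : √(n : ℝ) ^ 2 = n := Real.sq_sqrt hn0.le
  set s := x ^ 2 + y ^ 2 with hs
  have hs0 : 0 ≤ s := by positivity
  set r := √(s / n) with hr
  have hr2 : r ^ 2 = s / n := Real.sq_sqrt (by positivity)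
  have hr0 : 0 ≤ r := Real.sqrt_nonneg _
  have hrκ : r ≤ κ := by
    refine Real.sqrt_le_iff.2 ⟨hκ0.le, ?_⟩
    rwa [div_le_iff₀ hn0]
  have hcoord : ∀ z t : ℝ, t ^ 2 < 1 → z ^ 2 ≤ s → |z * (t / √n)| ≤ r := by
    intro z t ht hz
    refine abs_le_of_sq_le_sq ?_ hr0
    rw [hr2, mul_pow, div_pow, hsn2, ← mul_div_assoc]
    gcongr
    nlinarith [sq_nonneg z]
  have ha := hcoord x lam hl (by rw [hs]; linarith [sq_nonneg y])
  have hb' := hcoord y mu hm (by rw [hs]; linarith [sq_nonneg x])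
  set a := x * (lam / √n) with haa
  set b := y * (mu / √n) with hbb
  obtain ⟨i1, e1⟩ := hb a b r ha hb' (hrκ.trans (min_le_left _ _))
  obtain ⟨i2, e2⟩ := hb (-a) (-b) r (by rwa [abs_neg]) (by rwa [abs_neg])
    (hrκ.trans (min_le_left _ _))
  have hneg : ((-a) ^ 2 + (-b) ^ 2 + 2 * rho ^ 2 * (-a * -b)) / 2 + r ^ 3 * M
      = (a ^ 2 + b ^ 2 + 2 * rho ^ 2 * (a * b)) / 2 + r ^ 3 * M := by ring
  rw [hneg] at e2
  refine (h.truncCosh_le n D i1 i2 e1 e2).trans ?_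
  rw [← Real.exp_nat_mul]
  refine Real.exp_le_exp.2 ?_
  have h1 : (n : ℝ) * (a ^ 2 + b ^ 2 + 2 * rho ^ 2 * (a * b))
      = lam ^ 2 * x ^ 2 + mu ^ 2 * y ^ 2 + 2 * rho ^ 2 * ((lam * x) * (mu * y)) := by
    have : (n : ℝ) * (a ^ 2 + b ^ 2 + 2 * rho ^ 2 * (a * b))
        = n / √(n : ℝ) ^ 2 *
          (lam ^ 2 * x ^ 2 + mu ^ 2 * y ^ 2 + 2 * rho ^ 2 * ((lam * x) * (mu * y))) := by
      rw [haa, hbb]; ring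
    rw [this, hsn2, div_self hn0.ne', one_mul]
  have h2 : (n : ℝ) * (r ^ 3 * M) = s * (r * M) := by
    have : (n : ℝ) * r ^ 2 = s := by rw [hr2]; field_simp
    rw [← this]; ring
  have h3 : r * M ≤ δ / 2 := by
    have h4 : r ≤ δ / (2 * (M + 1)) := hrκ.trans (min_le_right _ _)
    rw [le_div_iff₀ (by positivity)] at h4
    nlinarith
  have h5 := hq x y
  rw [← hs] at h5
  have h6 : s * (r * M) ≤ s * (δ / 2) := by gcongr
  linarith

/-- Truncation extends the subgaussian bound to all arguments. -/
lemma SpikePrior.exists_overlapSum_le (h : SpikePrior rho prior) {lam mu δ : ℝ}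
    (hl : lam ^ 2 < 1) (hm : mu ^ 2 < 1) (hδ : 0 < δ) (hδ1 : 2 * δ ≤ 1)
    (hq : ∀ x y : ℝ, lam ^ 2 * x ^ 2 + mu ^ 2 * y ^ 2 + 2 * rho ^ 2 * ((lam * x) * (mu * y))
      ≤ (1 - 2 * δ) * (x ^ 2 + y ^ 2)) :
    ∃ c : ℝ, 0 < c ∧ ∀ n D : ℕ, 0 < n → (D : ℝ) ≤ c * n →
      overlapSum lam mu prior n D ≤ advantageBound δ ^ 2 := by
  obtain ⟨κ, hκ, hloc⟩ := h.exists_truncCosh_le_local hl hm hδ hq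
  -- Chosen so that `D ≤ (1-δ)R/2` with `R = κ²n`. The prior influences this range of `D` through
  -- `κ`, but not the final bound.
  refine ⟨(1 - δ) / 2 * κ ^ 2, mul_pos (by linarith) (by positivity), fun n D hn hD => ?_⟩
  obtain ⟨hi, he⟩ := h.overlapSum_eq lam mu n D
  obtain ⟨hi', he'⟩ := integral_exp_sq_prod δ hδ
  rw [he, ← he']
  refine integral_mono hi hi' fun g => ?_
  obtain ⟨x, y⟩ := g
  simp only
  have hn0 : (0 : ℝ) < n := by exact_mod_cast hn
  set R := κ ^ 2 * (n : ℝ) with hR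
  have hR0 : 0 < R := by positivity
  by_cases hxy : x ^ 2 + y ^ 2 ≤ R
  · exact hloc n D hn x y hxy
  · push Not at hxy
    set s := x ^ 2 + y ^ 2 with hs
    set t := √(s / R) with ht
    have hs0 : 0 < s := hR0.trans hxy
    have ht2 : t ^ 2 = s / R := Real.sq_sqrt (by positivity)
    have ht1 : 1 ≤ t := Real.one_le_sqrt.2 ((one_le_div hR0).2 hxy.le)
    have ht0 : 0 < t := by linarith
    -- Contract radially to the boundary of the local range, where the local bound still applies.
    have hs' : (x / t) ^ 2 + (y / t) ^ 2 = R := by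
      rw [div_pow, div_pow, ← add_div, ← hs, ht2]
      field_simp
    have h1 := hloc n D hn (x / t) (y / t) hs'.le
    rw [hs'] at h1
    have h2 := truncCosh_scale_le prior n D (x / t * (lam / √n)) (y / t * (mu / √n)) ht1
    have ex : t * (x / t * (lam / √n)) = x * (lam / √n) := by field_simp
    have ey : t * (y / t * (mu / √n)) = y * (mu / √n) := by field_simp
    rw [ex, ey] at h2
    refine h2.trans ?_
    -- Since `R(t² - 1) = s - R`, the scaling loss is at most the growth of the target exponential
    -- between the boundary and `(x, y)`.
    have h3 : (t ^ 2) ^ D ≤ Real.exp ((1 - δ) / 2 * (s - R)) := by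
      calc (t ^ 2) ^ D ≤ Real.exp (t ^ 2 - 1) ^ D := by
            gcongr
            linarith [Real.add_one_le_exp (t ^ 2 - 1)]
        _ = Real.exp (D * (t ^ 2 - 1)) := by rw [← Real.exp_nat_mul]
        _ ≤ _ := by
            refine Real.exp_le_exp.2 ?_
            have hDR : (D : ℝ) ≤ (1 - δ) / 2 * R := by rw [hR]; linarith
            have h0 : 0 ≤ t ^ 2 - 1 := by nlinarith
            calc (D : ℝ) * (t ^ 2 - 1) ≤ (1 - δ) / 2 * R * (t ^ 2 - 1) := by gcongr
              _ = _ := by rw [ht2]; field_simp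
    calc _ ≤ Real.exp ((1 - δ) / 2 * (s - R)) * Real.exp ((1 - δ) / 2 * R) :=
          (mul_le_mul_of_nonneg_left h1 (by positivity)).trans
            (mul_le_mul_of_nonneg_right h3 (Real.exp_pos _).le)
      _ = _ := by rw [← Real.exp_add]; congr 1; ring

/-- An exponent eventually at most `1/2` is enough, since `√n ≤ c n` once `√n ≥ 1/c`. -/
lemma IsSubpolynomial.eventually_le {D : ℕ → ℕ} (hD : IsSubpolynomial D) {c : ℝ} (hc : 0 < c) :
    ∀ᶠ n : ℕ in atTop, (D n : ℝ) ≤ c * n := by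
  obtain ⟨η, hη, hle⟩ := hD
  have h1 : ∀ᶠ n : ℕ in atTop, η n ≤ 1 / 2 := hη.eventually_le_const (by norm_num)
  have h2 : ∀ᶠ n : ℕ in atTop, 1 / c ≤ √(n : ℝ) :=
    (Real.tendsto_sqrt_atTop.comp tendsto_natCast_atTop_atTop).eventually_ge_atTop _
  filter_upwards [hle, h1, h2, eventually_ge_atTop 1] with n h3 h4 h5 h6
  have hn : (1 : ℝ) ≤ n := by exact_mod_cast h6
  calc (D n : ℝ) ≤ (n : ℝ) ^ η n := h3
    _ ≤ (n : ℝ) ^ (1 / 2 : ℝ) := Real.rpow_le_rpow_of_exponent_le hn h4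
    _ = √(n : ℝ) := (Real.sqrt_eq_rpow _).symm
    _ ≤ c * √(n : ℝ) * √(n : ℝ) := by
        rw [div_le_iff₀ hc] at h5
        nlinarith [Real.sqrt_nonneg (n : ℝ)]
    _ = c * n := by rw [mul_assoc, Real.mul_self_sqrt (by linarith)]

lemma SpikePrior.integral_plantedLaw_le (h : SpikePrior rho prior) (lam mu : ℝ) {n D : ℕ}
    {K : ℝ} (hK : 0 ≤ K) (hS : overlapSum lam mu prior n D ≤ K ^ 2) (f : MatPoly n)
    (hf : f.totalDegree ≤ D) :
    |∫ M, evalPoly f M ∂plantedLaw lam mu prior n|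
      ≤ K * √(∫ M, evalPoly f M ^ 2 ∂nullLaw n) := by
  have h0 : 0 ≤ ∫ M, evalPoly f M ^ 2 ∂nullLaw n := integral_nonneg fun _ => sq_nonneg _
  refine abs_le_of_sq_le_sq ?_ (by positivity)
  rw [mul_pow, Real.sq_sqrt h0, mul_comm (K ^ 2)]
  exact (h.sq_integral_plantedLaw_le lam mu f hf).trans (by gcongr)

lemma SpikePrior.lowDegreeAdvantage_le (h : SpikePrior rho prior) (lam mu : ℝ) {n D : ℕ}
    {K : ℝ} (hK : 0 ≤ K) (hS : overlapSum lam mu prior n D ≤ K ^ 2) :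
    lowDegreeAdvantage D (plantedLaw lam mu prior n) (nullLaw n) ≤ (K : EReal) := by
  refine iSup_le fun f => EReal.coe_le_coe_iff.2 ?_
  have h1 := (le_abs_self _).trans (h.integral_plantedLaw_le lam mu hK hS f.1 f.2.2)
  -- No positivity of the null second moment is needed: a zero denominator makes the quotient `0 ≤
  -- K`.
  exact div_le_of_le_mul₀ (Real.sqrt_nonneg _) hK h1

lemma hasAllMoments_evalPoly_of_entries {n : ℕ} {μ : Measure (RMat n × RMat n)} [IsFiniteMeasure μ]
    (hw : ∀ e, HasAllMoments (fun M => entries M e) μ) (f : MatPoly n) :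
    HasAllMoments (evalPoly f) μ := by
  have : evalPoly f = fun M => ∑ d ∈ f.support, f.coeff d * ∏ e, entries M e ^ d e := by
    ext M; rw [evalPoly_eq, MvPolynomial.eval_eq']
  rw [this]
  exact HasAllMoments.sum _ fun d _ => (HasAllMoments.const _).mul
    (HasAllMoments.prod _ fun e _ => (hw e).pow _)

lemma SpikePrior.integrable_evalPoly_plantedLaw (h : SpikePrior rho prior) (lam mu : ℝ) {n : ℕ}
    (f : MatPoly n) : Integrable (evalPoly f) (plantedLaw lam mu prior n) := by
  have := h.isProbabilityMeasure
  have : IsProbabilityMeasure (plantedLaw lam mu prior n) :=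
    Measure.isProbabilityMeasure_map (measurable_plantedMap lam mu).aemeasurable
  refine (hasAllMoments_evalPoly_of_entries (fun e p => ?_) f).integrable
  have hmeas : Measurable fun M : RMat n × RMat n => entries M e := by
    rcases e with e | e <;> simp only [entries, Sum.elim_inl, Sum.elim_inr] <;> fun_prop
  rw [plantedLaw, memLp_map_measure_iff hmeas.aestronglyMeasurable
    (measurable_plantedMap lam mu).aemeasurable]
  have := ((h.hasAllMoments_spikeVec lam mu e).comp_measurePreserving
    (measurePreserving_fst (ν := nullLaw n))).add
    ((hasAllMoments_entries n e).comp_measurePreserving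
      (measurePreserving_snd (μ := Measure.pi fun _ : Fin n => prior)))
  convert! this p using 1
  ext ω
  rcases e with e | e <;> rfl

/-- The mean gap is controlled by the standard deviation under the null law. -/
lemma SpikePrior.meanGap_le (h : SpikePrior rho prior) (lam mu : ℝ) {n D : ℕ}
    {K : ℝ} (hK : 0 ≤ K) (hS : overlapSum lam mu prior n D ≤ K ^ 2) (f : MatPoly n)
    (hf : f.totalDegree ≤ D) :
    meanGap (plantedLaw lam mu prior n) (nullLaw n) f
      ≤ K * √(variance (evalPoly f) (nullLaw n)) := by
  have := h.isProbabilityMeasure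
  have : IsProbabilityMeasure (plantedLaw lam mu prior n) :=
    Measure.isProbabilityMeasure_map (measurable_plantedMap lam mu).aemeasurable
  set m := ∫ M, evalPoly f M ∂nullLaw n with hm
  have he : ∀ M, evalPoly (f - MvPolynomial.C m) M = evalPoly f M - m := fun M => by
    simp [evalPoly]
  -- Centring at the null mean keeps the degree at most `D` and turns the null second moment into
  -- the variance.
  have h1 := h.integral_plantedLaw_le lam mu hK hS (f - MvPolynomial.C m)
    ((MvPolynomial.totalDegree_sub_C_le f m).trans hf)
  simp_rw [he] at h1
  rw [integral_sub (h.integrable_evalPoly_plantedLaw lam mu f) (integrable_const m)] at h1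
  rw [meanGap, variance_eq_integral (measurable_evalPoly f).aemeasurable]
  simpa using h1

end

theorem mainTheorem1 (lam mu rho eps : ℝ) (hlam : 0 ≤ lam) (hmu : 0 ≤ mu)
    (hrho : 0 ≤ rho ∧ rho ≤ 1) (heps : 0 < eps) (hF : thresholdF lam mu rho 1 < 1 - eps) :
    ∃ K : ℝ, ∀ prior : Measure (ℝ × ℝ), SpikePrior rho prior →
      ∀ D : ℕ → ℕ, IsSubpolynomial D →
        (∀ᶠ n in atTop,
          lowDegreeAdvantage (D n) (plantedLaw lam mu prior n) (nullLaw n) ≤ (K : EReal)) ∧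
        (⨆ n, lowDegreeAdvantage (D n) (plantedLaw lam mu prior n) (nullLaw n)) < ⊤ ∧
        ∀ f : ∀ n : ℕ, MatPoly n, (∀ n, (f n).totalDegree ≤ D n) →
          ¬ StronglySeparates (plantedLaw lam mu prior) nullLaw f := by
  obtain ⟨hl, hm, δ, hδ, hδ1, hq⟩ := exists_gap_of_thresholdF_lt heps hF
  set K := advantageBound δ with hKdef
  have hK : 0 ≤ K := advantageBound_nonneg δ
  refine ⟨K, fun prior h D hD => ?_⟩
  obtain ⟨c, hc, hbound⟩ := h.exists_overlapSum_le hl hm hδ hδ1 hq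
  have hS : ∀ᶠ n in atTop, overlapSum lam mu prior n (D n) ≤ K ^ 2 := by
    filter_upwards [hD.eventually_le hc, eventually_ge_atTop 1] with n h1 h2
    exact hbound n (D n) h2 h1
  refine ⟨?_, ?_, ?_⟩
  · filter_upwards [hS] with n hn
    exact h.lowDegreeAdvantage_le lam mu hK hn
  · obtain ⟨N, hN⟩ := eventually_atTop.1 hS
    -- The finitely many `n < N` are absorbed by adding their overlap sums, each of which is a
    -- finite real.
    set B : ℝ := K ^ 2 + ∑ n ∈ Finset.range N, |overlapSum lam mu prior n (D n)| with hB
    have hsum : ∀ s : Finset ℕ, 0 ≤ ∑ n ∈ s, |overlapSum lam mu prior n (D n)| := fun s =>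
      Finset.sum_nonneg fun _ _ => abs_nonneg _
    have hB0 : 0 ≤ B := add_nonneg (sq_nonneg K) (hsum _)
    have hle : ∀ n, overlapSum lam mu prior n (D n) ≤ √B ^ 2 := by
      intro n
      rw [Real.sq_sqrt hB0]
      by_cases hn : N ≤ n
      · exact (hN n hn).trans (by rw [hB]; linarith [hsum (Finset.range N)])
      · have := Finset.single_le_sum (f := fun n => |overlapSum lam mu prior n (D n)|)
          (fun _ _ => abs_nonneg _) (Finset.mem_range.2 (not_le.1 hn))
        have h2 := le_abs_self (overlapSum lam mu prior n (D n))
        rw [hB]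
        linarith [sq_nonneg K]
    exact (iSup_le fun n => h.lowDegreeAdvantage_le lam mu (Real.sqrt_nonneg B) (hle n)).trans_lt
      (EReal.coe_lt_top _)
  · rintro f hf ⟨hpos, ho⟩
    -- With this constant the bound by `K` times the null standard deviation gives `gap ≤ gap / 2`,
    -- contradicting a positive gap.
    have hsmall := ho.def (c := 1 / (2 * (K + 1))) (by positivity)
    obtain ⟨n, hn1, hn2, hn3⟩ := (hpos.and (hsmall.and hS)).exists
    have h1 := h.meanGap_le lam mu hK hn3 (f n) (hf n)
    rw [Real.norm_of_nonneg (Real.sqrt_nonneg _), Real.norm_of_nonneg hn1.le] at hn2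
    have h2 : √(variance (evalPoly (f n)) (nullLaw n))
        ≤ 1 / (2 * (K + 1)) * meanGap (plantedLaw lam mu prior n) (nullLaw n) (f n) :=
      (Real.sqrt_le_sqrt (le_max_right _ _)).trans hn2
    have h3 : K * (1 / (2 * (K + 1))) ≤ 1 / 2 := by
      rw [mul_one_div, div_le_div_iff₀ (by positivity) (by positivity)]
      linarith
    have h4 := h1.trans (mul_le_mul_of_nonneg_left h2 hK)
    rw [← mul_assoc] at h4
    nlinarith
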